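/- Let $n\ge 2$ be an integer and let $\Theta(0)\in\mathbb{R}^n$ be a unit vector. Let $(\beta_s)_{s\ge0}$ be a one-dimensional Brownian motion and let $(B'_s)_{s\ge0}$ be an $(n-1)$-dimensional Brownian motion with values in the hyperplane of $\mathbb{R}^n$ orthogonal to $\Theta(0)$. With stochastic integrals taken in their continuous versions, put $$G^{(0)}_t=\int_0^t\sqrt{1-e^{-ns}}\,e^{\frac{n-1}{2}s}\,d\beta_s-\int_0^t e^{\frac{n-1}{2}s}\,d\beta_s ,\qquad G'_t=\int_0^t\sqrt{1+\frac{e^{-ns}}{n-1}}\,e^{\frac{n-1}{2}s}\,dB'_s-\int_0^t e^{\frac{n-1}{2}s}\,dB'_s .$$ Then $(G^{(0)}_t\Theta(0))_{t\ge0}$ and $(G'_t)_{t\ge0}$ are Gaussian martingales, and they converge almost surely and in $L^2$ as $t\to\infty$. The limits are centered Gaussian variables: * the limit of $G^{(0)}_t\Theta(0)$ is $Z\,\Theta(0)$, where $Z$ is a real centered Gaussian variable with variance $$-\frac{\sqrt{\pi}\,\Gamma\left(-1+\frac1n\right)}{n\,\Gamma\left(\frac12+\frac1n\right)}-\frac{n+1}{n-1};$$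 * the limit of $G'_t$ is a centered Gaussian vector with covariance matrix $v'\,\bigl(\delta_{ij}-\Theta_i(0)\Theta_j(0)\bigr)_{i,j\le n}$, that is, with variance $v'$ in every direction of the hyperplane orthogonal to $\Theta(0)$, where $$v'=\frac{2\;{}_2F_1\left(-\frac12,-1+\frac1n;\frac1n;\frac{1}{1-n}\right)-1}{n-1}.$$ -/

import Mathlib

open MeasureTheory ProbabilityTheory Filter Topology
open scoped NNReal ENNReal RealInnerProductSpace

/-- A deterministic step function `∑ i < num, coef i * 1_(pts i, pts (i+1)]` on the half line. -/
structure StepFun where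
  num : ℕ
  pts : ℕ → ℝ≥0
  mono : Monotone pts
  coef : ℕ → ℝ

/-- The value of a step function at `s`. -/
noncomputable def StepFun.eval (h : StepFun) (s : ℝ) : ℝ :=
  ∑ i ∈ Finset.range h.num,
    (Set.Ioc (h.pts i : ℝ) (h.pts (i + 1) : ℝ)).indicator (fun _ ↦ h.coef i) s

/-- The elementary stochastic integral `∫₀ᵗ h dX` of a step function `h` against the (real- or
vector-valued) process `X`. -/
noncomputable def StepFun.integral {Ω E : Type*} [AddCommGroup E] [Module ℝ E]
    (h : StepFun) (X : ℝ≥0 → Ω → E) (t : ℝ≥0) (ω : Ω) : E :=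
  ∑ i ∈ Finset.range h.num,
    h.coef i • (X (min (h.pts (i + 1)) t) ω - X (min (h.pts i) t) ω)

/-- `G` is a version with almost surely continuous paths of the stochastic integral process
`t ↦ ∫₀ᵗ f(s) dX_s` of the deterministic function `f`: for every `t`, the variable `G t` is the
limit in `L²(P)` of the elementary integrals `∫₀ᵗ h_k dX` of step functions `h_k` which converge
to `f` in `L²([0, t])`. -/
structure IsWienerIntegral {Ω E : Type*} [MeasurableSpace Ω] [NormedAddCommGroup E]
    [NormedSpace ℝ E] (P : Measure Ω) (X : ℝ≥0 → Ω → E) (f : ℝ → ℝ) (G : ℝ≥0 → Ω → E) :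
    Prop where
  stronglyMeasurable : ∀ t, StronglyMeasurable (G t)
  continuous : ∀ᵐ ω ∂P, Continuous fun t ↦ G t ω
  isLimit : ∀ t : ℝ≥0, ∃ h : ℕ → StepFun,
    Tendsto (fun k ↦ eLpNorm (fun s ↦ f s - (h k).eval s) 2
      (volume.restrict (Set.Ioc (0 : ℝ) t))) atTop (𝓝 0) ∧
    Tendsto (fun k ↦ eLpNorm (fun ω ↦ G t ω - (h k).integral X t ω) 2 P) atTop (𝓝 0)

open Classical in
/-- The stochastic integral process `t ↦ ∫₀ᵗ f(s) dX_s`, with almost surely continuous paths. For a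
Brownian motion `X` and a locally square integrable `f`, it exists and is unique up to
indistinguishability. (The value is `0` if there is no such process.) -/
noncomputable def wienerIntegral {Ω E : Type*} [MeasurableSpace Ω] [NormedAddCommGroup E]
    [NormedSpace ℝ E] (P : Measure Ω) (X : ℝ≥0 → Ω → E) (f : ℝ → ℝ) : ℝ≥0 → Ω → E :=
  if h : ∃ G, IsWienerIntegral P X f G then h.choose else 0

/-- `X` is a Brownian motion with values in (a translate of) the subspace `V`, of dimension
`dim V`: with respect to an orthonormal basis of `V`, the coordinates of `X - X 0` are independent
real standard Brownian motions. -/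
def IsBrownianIn {Ω E : Type*} [MeasurableSpace Ω] [NormedAddCommGroup E]
    [InnerProductSpace ℝ E] (V : Submodule ℝ E) (X : ℝ≥0 → Ω → E) (P : Measure Ω) : Prop :=
  ∃ (b : OrthonormalBasis (Fin (Module.finrank ℝ V)) ℝ V)
    (W : Fin (Module.finrank ℝ V) → ℝ≥0 → Ω → ℝ),
    (∀ i, IsBrownianReal (W i) P) ∧ iIndepFun (fun i ω t ↦ W i t ω) P ∧
    ∀ᵐ ω ∂P, ∀ t, X t ω - X 0 ω = ∑ i, W i t ω • (b i : E)

/-- The symmetric matrix `σ(x) = (δ_{ij} - x_i x_j)`. -/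
def sigmaMatrix {n : ℕ} (x : EuclideanSpace ℝ (Fin n)) : Matrix (Fin n) (Fin n) ℝ :=
  Matrix.of fun i j ↦ (if i = j then 1 else 0) - x i * x j

/-- `G⁰_t = ∫₀ᵗ √(1 - e^{-ns}) e^{(n-1)s/2} dβ_s - ∫₀ᵗ e^{(n-1)s/2} dβ_s`. -/
noncomputable def radialG {Ω : Type*} [MeasurableSpace Ω] (P : Measure Ω) (n : ℕ)
    (β : ℝ≥0 → Ω → ℝ) (t : ℝ≥0) (ω : Ω) : ℝ :=
  wienerIntegral P β
      (fun s ↦ √(1 - Real.exp (-(n * s))) * Real.exp (((n : ℝ) - 1) / 2 * s)) t ω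
    - wienerIntegral P β (fun s ↦ Real.exp (((n : ℝ) - 1) / 2 * s)) t ω

/-- `G'_t = ∫₀ᵗ √(1 + e^{-ns}/(n-1)) e^{(n-1)s/2} dB'_s - ∫₀ᵗ e^{(n-1)s/2} dB'_s`. -/
noncomputable def tangentialG {Ω : Type*} [MeasurableSpace Ω] (P : Measure Ω) (n : ℕ)
    (B' : ℝ≥0 → Ω → EuclideanSpace ℝ (Fin n)) (t : ℝ≥0) (ω : Ω) : EuclideanSpace ℝ (Fin n) :=
  wienerIntegral P B'
      (fun s ↦ √(1 + Real.exp (-(n * s)) / ((n : ℝ) - 1)) * Real.exp (((n : ℝ) - 1) / 2 * s)) t ω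
    - wienerIntegral P B' (fun s ↦ Real.exp (((n : ℝ) - 1) / 2 * s)) t ω

/-!
Both processes have the form `∑ i, (∫₀ᵗ g dW i) • b i`, with independent Brownian motions `W i`, fixed
vectors `b i` and the deterministic integrand `g s = (√(1 + κ e^{-ns}) - 1) e^{(n-1)s/2}`, where
`κ = -1` for the radial process and `κ = 1 / (n - 1)` for the tangential one. The single integrands
grow exponentially, but `g` is `O(e^{-(n+1)s/2})`.

The integrands are differentiable on `(0, ∞)` with locally integrable derivative, so their Wiener
integrals are given path by path by the integration by parts formula
`f t * w t - f 0 * w 0 - ∫₀ᵗ f' w` (`pathIntegral`). It is the limit of Riemann sums of continuous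
paths, and by the isometry on step functions also their `L²` limit. Hence it is a continuous version
of the Wiener integral, and any other such version is indistinguishable from it
(`IsWienerIntegral.ae_eq_sum_pathIntegral`).

* An `L²` limit of Gaussian processes is Gaussian (`IsGaussianProcess.of_tendsto_eLpNorm`), so the
  pathwise integrals against all the `W i` form one Gaussian process. Their increments are
  uncorrelated with the past, hence independent of it, which gives the martingale property for the
  natural filtration (`martingale_of_ae_eq_sum_pathIntegral`).
* Time inversion shows that almost every Brownian path grows at most linearly
  (`IsRegularBrownian.ae_exists_bound`). As `g` and `g'` decay exponentially, the integration by
  parts formula converges as `t → ∞` along every such path.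
  By Fatou's lemma and the isometry the limits are also `L²` limits;
  they are therefore centered Gaussian, uncorrelated for different `i`, with variance `∫₀^∞ g²`
  (`exists_limit_pathIntegral`).
* The substitution `u = e^{-ns}` gives
  `∫₀^∞ g² = κ - (2 / n) ∫₀¹ (√(1 + κ u) - 1) u^(1/n - 2) du`. For `κ = -1` the last integral
  reduces to a beta integral (`integral_kernel_neg_one_sub_sq`). For `κ = 1 / (n - 1)` the binomial
  series is integrated term by term and yields the hypergeometric series
  (`integral_kernel_sub_sq_eq_ordinaryHypergeometric`); for `n = 2` this happens on the circle of
  convergence, where the binomial series of the square root still converges absolutely.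

For the tangential process the `b i` form an orthonormal basis of the hyperplane orthogonal to `θ`, and
`∑ k, b k i * b k j` is the matrix of the orthogonal projection onto that hyperplane.
-/

/-! ### Inner products and norms in `L²` -/

section LTwo

variable {α : Type*} {mα : MeasurableSpace α} {μ : Measure α}

lemma eLpNorm_two_eq_ofReal_sqrt {f : α → ℝ} (hf : MemLp f 2 μ) :
    eLpNorm f 2 μ = ENNReal.ofReal √(∫ x, f x * f x ∂μ) := by
  rw [hf.eLpNorm_eq_integral_rpow_norm (by norm_num) (by norm_num), Real.sqrt_eq_rpow]
  simp only [ENNReal.toReal_ofNat, Real.rpow_ofNat, Real.norm_eq_abs, sq_abs, one_div]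
  simp only [pow_two]

lemma tendsto_integral_mul_of_tendsto_eLpNorm {κ : Type*} {l : Filter κ} {f g : κ → α → ℝ}
    {F G : α → ℝ} (hf : ∀ k, MemLp (f k) 2 μ) (hg : ∀ k, MemLp (g k) 2 μ) (hF : MemLp F 2 μ)
    (hG : MemLp G 2 μ) (hfF : Tendsto (fun k ↦ eLpNorm (f k - F) 2 μ) l (𝓝 0))
    (hgG : Tendsto (fun k ↦ eLpNorm (g k - G) 2 μ) l (𝓝 0)) :
    Tendsto (fun k ↦ ∫ x, f k x * g k x ∂μ) l (𝓝 (∫ x, F x * G x ∂μ)) := by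
  have key : ∀ {u v : α → ℝ} (hu : MemLp u 2 μ) (hv : MemLp v 2 μ),
      inner ℝ (hv.toLp v) (hu.toLp u) = ∫ x, u x * v x ∂μ := by
    intro u v hu hv
    rw [L2.inner_def]
    refine integral_congr_ae ?_
    filter_upwards [hu.coeFn_toLp, hv.coeFn_toLp] with x h1 h2
    simp [h1, h2]
  have h1 := (Lp.tendsto_Lp_iff_tendsto_eLpNorm'' f hf F hF).2 hfF
  have h2 := (Lp.tendsto_Lp_iff_tendsto_eLpNorm'' g hg G hG).2 hgG
  simpa only [key] using h2.inner (𝕜 := ℝ) h1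

lemma tendsto_integral_of_tendsto_eLpNorm_two [IsProbabilityMeasure μ] {κ : Type*} {l : Filter κ}
    {f : κ → α → ℝ} {F : α → ℝ} (hf : ∀ k, MemLp (f k) 2 μ) (hF : MemLp F 2 μ)
    (hfF : Tendsto (fun k ↦ eLpNorm (f k - F) 2 μ) l (𝓝 0)) :
    Tendsto (fun k ↦ ∫ x, f k x ∂μ) l (𝓝 (∫ x, F x ∂μ)) := by
  have h : MemLp (fun _ : α ↦ (1 : ℝ)) 2 μ := memLp_const 1
  simpa using tendsto_integral_mul_of_tendsto_eLpNorm (g := fun _ _ ↦ (1 : ℝ)) (G := fun _ ↦ 1)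
    hf (fun _ ↦ h) hF h hfF (by simp [tendsto_const_nhds])

/-- An `Lᵖ`-Cauchy sequence which converges almost everywhere converges in `Lᵖ` to its pointwise
limit, by Fatou's lemma. -/
lemma tendsto_eLpNorm_sub_of_cauchy_of_ae_tendsto {E : Type*} [NormedAddCommGroup E] {p : ℝ≥0∞}
    {f : ℕ → α → E} {F : α → E} (hf : ∀ k, AEStronglyMeasurable (f k) μ)
    (hlim : ∀ᵐ x ∂μ, Tendsto (fun k ↦ f k x) atTop (𝓝 (F x))) {B : ℕ → ℝ≥0∞}
    (hB : Tendsto B atTop (𝓝 0)) (hcau : ∀ k m, eLpNorm (f m - f k) p μ ≤ B m + B k) :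
    Tendsto (fun k ↦ eLpNorm (F - f k) p μ) atTop (𝓝 0) := by
  refine tendsto_of_tendsto_of_tendsto_of_le_of_le tendsto_const_nhds hB (fun _ ↦ zero_le) ?_
  intro k
  refine (Lp.eLpNorm_lim_le_liminf_eLpNorm (f := fun m ↦ f m - f k)
    (fun m ↦ (hf m).sub (hf k)) _ ?_).trans ?_
  · filter_upwards [hlim] with x hx
    exact hx.sub_const _
  · have h : Tendsto (fun m ↦ B m + B k) atTop (𝓝 (B k)) := by
      simpa using hB.add (tendsto_const_nhds (x := B k))
    exact (liminf_le_liminf (Eventually.of_forall (hcau k))).trans h.liminf_eq.le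

variable {T : Type*}

lemma memLp_linearCombination {u : T → α → ℝ} (hu : ∀ a, MemLp (u a) 2 μ) (c : T →₀ ℝ) :
    MemLp (Finsupp.linearCombination ℝ u c) 2 μ := by
  rw [Finsupp.linearCombination_apply, Finsupp.sum]
  exact memLp_finsetSum' _ fun a _ ↦ (hu a).const_smul _

lemma integral_linearCombination_mul {u v : T → α → ℝ} (hu : ∀ a, MemLp (u a) 2 μ)
    (hv : ∀ a, MemLp (v a) 2 μ) (c d : T →₀ ℝ) :
    ∫ x, Finsupp.linearCombination ℝ u c x * Finsupp.linearCombination ℝ v d x ∂μ =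
      ∑ a ∈ c.support, ∑ b ∈ d.support, c a * d b * ∫ x, u a x * v b x ∂μ := by
  have hint : ∀ a b, Integrable (fun x ↦ c a * d b * (u a x * v b x)) μ := fun a b ↦
    ((hu a).integrable_mul (hv b)).const_mul _
  simp_rw [Finsupp.linearCombination_apply, Finsupp.sum, Finset.sum_apply, Pi.smul_apply,
    smul_eq_mul, Finset.sum_mul_sum, ← integral_const_mul]
  simp_rw [show ∀ a b x, c a * u a x * (d b * v b x) = c a * d b * (u a x * v b x) by intros; ring]
  rw [integral_finsetSum _ fun a _ ↦ integrable_finsetSum _ fun b _ ↦ hint a b]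
  exact Finset.sum_congr rfl fun a _ ↦ integral_finsetSum _ fun b _ ↦ hint a b

end LTwo

/-! ### The elementary integral as an isometry -/

/-- The indicator functions of the intervals `(0, a]`. Their Gram matrix in `L²(ℝ)` is
`min a b`, the covariance of Brownian motion. -/
noncomputable def initialIndicator (a : ℝ≥0) : ℝ → ℝ :=
  (Set.Ioc (0 : ℝ) a).indicator 1

lemma memLp_initialIndicator (a : ℝ≥0) : MemLp (initialIndicator a) 2 volume :=
  memLp_indicator_const 2 measurableSet_Ioc (1 : ℝ) (Or.inr (by simp))

lemma integral_initialIndicator_mul (a b : ℝ≥0) :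
    ∫ x, initialIndicator a x * initialIndicator b x = min (a : ℝ) b := by
  simp_rw [initialIndicator, ← Set.inter_indicator_mul, Set.Ioc_inter_Ioc]
  rw [integral_indicator measurableSet_Ioc]
  simp

namespace StepFun

/-- The elementary integral of `h` up to time `t` is a linear combination of values of the
integrator; these are its coefficients. -/
noncomputable def stoppedCoeff (h : StepFun) (t : ℝ≥0) : ℝ≥0 →₀ ℝ :=
  ∑ i ∈ Finset.range h.num, h.coef i •
    (Finsupp.single (min (h.pts (i + 1)) t) 1 - Finsupp.single (min (h.pts i) t) 1)

lemma linearCombination_stoppedCoeff {Ω : Type*} (h : StepFun) (X : ℝ≥0 → Ω → ℝ) (t : ℝ≥0) :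
    Finsupp.linearCombination ℝ X (h.stoppedCoeff t) = h.integral X t := by
  ext ω
  simp [stoppedCoeff, StepFun.integral, Finset.sum_apply]

lemma integral_initialIndicator_eq_indicator_eval (h : StepFun) (t : ℝ≥0) :
    h.integral initialIndicator t = (Set.Ioc (0 : ℝ) t).indicator h.eval := by
  ext s
  rw [StepFun.integral, Set.indicator_apply]
  by_cases hs : s ∈ Set.Ioc (0 : ℝ) t
  · rw [if_pos hs, StepFun.eval]
    refine Finset.sum_congr rfl fun i _ ↦ ?_
    have hm : (h.pts i : ℝ) ≤ h.pts (i + 1) := by exact_mod_cast h.mono (Nat.le_succ i)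
    obtain ⟨h0, h1⟩ := hs
    simp only [initialIndicator, Set.indicator_apply, Set.mem_Ioc, h0, h1, true_and, NNReal.coe_min,
      le_min_iff, and_true, Pi.one_apply, smul_eq_mul]
    grind
  · rw [if_neg hs]
    refine Finset.sum_eq_zero fun i _ ↦ ?_
    have : ∀ a : ℝ≥0, initialIndicator (min a t) s = 0 := by
      intro a
      refine Set.indicator_of_notMem (fun h' ↦ hs ⟨h'.1, h'.2.trans ?_⟩) _
      exact_mod_cast min_le_right a t
    simp [this]

lemma memLp_eval (h : StepFun) : MemLp h.eval 2 volume := by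
  have : h.eval = ∑ i ∈ Finset.range h.num,
      (Set.Ioc (h.pts i : ℝ) (h.pts (i + 1) : ℝ)).indicator (fun _ ↦ h.coef i) := by
    ext s
    simp [StepFun.eval, Finset.sum_apply]
  rw [this]
  exact memLp_finsetSum' _ fun i _ ↦ memLp_indicator_const 2 measurableSet_Ioc _ (Or.inr (by simp))

end StepFun

section Isometry

variable {Ω : Type*} {mΩ : MeasurableSpace Ω} {P : Measure Ω}

lemma ProbabilityTheory.IsPreBrownianReal.memLp_two {W : ℝ≥0 → Ω → ℝ} (hW : IsPreBrownianReal W P)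
    (t : ℝ≥0) : MemLp (W t) 2 P :=
  (hW.isGaussianProcess.hasGaussianLaw_eval t).memLp_two

lemma ProbabilityTheory.IsPreBrownianReal.integral_mul {W : ℝ≥0 → Ω → ℝ}
    (hW : IsPreBrownianReal W P) (s t : ℝ≥0) : ∫ ω, W s ω * W t ω ∂P = min (s : ℝ) t := by
  have := hW.isGaussianProcess.isProbabilityMeasure
  have h := hW.covariance_eval s t
  rw [covariance_eq_sub (hW.memLp_two s) (hW.memLp_two t)] at h
  simpa [hW.integral_eval] using h

lemma StepFun.memLp_integral {W : ℝ≥0 → Ω → ℝ} (hW : ∀ t, MemLp (W t) 2 P) (h : StepFun)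
    (t : ℝ≥0) : MemLp (h.integral W t) 2 P := by
  rw [← h.linearCombination_stoppedCoeff]
  exact memLp_linearCombination hW _

/-- The isometry of the Wiener integral, in polarized form. -/
lemma StepFun.integral_integral_mul_integral {W : ℝ≥0 → Ω → ℝ} (hW : IsPreBrownianReal W P)
    (h k : StepFun) (s t : ℝ≥0) :
    ∫ ω, h.integral W s ω * k.integral W t ω ∂P =
      ∫ x, (Set.Ioc (0 : ℝ) s).indicator h.eval x * (Set.Ioc (0 : ℝ) t).indicator k.eval x := by
  simp_rw [← StepFun.integral_initialIndicator_eq_indicator_eval,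
    ← StepFun.linearCombination_stoppedCoeff]
  rw [integral_linearCombination_mul hW.memLp_two hW.memLp_two,
    integral_linearCombination_mul memLp_initialIndicator memLp_initialIndicator]
  simp_rw [hW.integral_mul, integral_initialIndicator_mul]

lemma StepFun.integral_integral_mul_integral_of_indepFun {W V : ℝ≥0 → Ω → ℝ}
    (hW : IsPreBrownianReal W P) (hV : IsPreBrownianReal V P)
    (hWV : ∀ s t, IndepFun (W s) (V t) P) (h k : StepFun) (s t : ℝ≥0) :
    ∫ ω, h.integral W s ω * k.integral V t ω ∂P = 0 := by
  simp_rw [← StepFun.linearCombination_stoppedCoeff]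
  rw [integral_linearCombination_mul hW.memLp_two hV.memLp_two]
  refine Finset.sum_eq_zero fun a _ ↦ Finset.sum_eq_zero fun b _ ↦ ?_
  rw [(hWV a b).integral_fun_mul_eq_mul_integral (hW.memLp_two a).1 (hV.memLp_two b).1,
    hW.integral_eval]
  simp

/-- The isometry of the Wiener integral, for a difference of step functions: both sides depend only
on the Gram matrix of the values of `W`, respectively of the indicators of `(0, a]`. -/
lemma StepFun.eLpNorm_integral_sub {W : ℝ≥0 → Ω → ℝ} (hW : IsPreBrownianReal W P)
    (h k : StepFun) (t : ℝ≥0) :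
    eLpNorm (h.integral W t - k.integral W t) 2 P =
      eLpNorm (h.eval - k.eval) 2 (volume.restrict (Set.Ioc (0 : ℝ) t)) := by
  have e1 : h.integral W t - k.integral W t =
      Finsupp.linearCombination ℝ W (h.stoppedCoeff t - k.stoppedCoeff t) := by
    rw [map_sub, StepFun.linearCombination_stoppedCoeff, StepFun.linearCombination_stoppedCoeff]
  have e2 : (Set.Ioc (0 : ℝ) t).indicator (h.eval - k.eval) =
      Finsupp.linearCombination ℝ initialIndicator (h.stoppedCoeff t - k.stoppedCoeff t) := by
    rw [map_sub, StepFun.linearCombination_stoppedCoeff, StepFun.linearCombination_stoppedCoeff,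
      StepFun.integral_initialIndicator_eq_indicator_eval,
      StepFun.integral_initialIndicator_eq_indicator_eval, Set.indicator_sub']
  rw [← eLpNorm_indicator_eq_eLpNorm_restrict measurableSet_Ioc, e1, e2,
    eLpNorm_two_eq_ofReal_sqrt (memLp_linearCombination hW.memLp_two _),
    eLpNorm_two_eq_ofReal_sqrt (memLp_linearCombination memLp_initialIndicator _),
    integral_linearCombination_mul hW.memLp_two hW.memLp_two,
    integral_linearCombination_mul memLp_initialIndicator memLp_initialIndicator]
  simp_rw [hW.integral_mul, integral_initialIndicator_mul]

end Isometry

/-! ### Integration by parts: a pathwise version of the Wiener integral -/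

/-- `f` is continuous, differentiable on `(0, ∞)` with derivative `f'`, and `f'` is locally
integrable on `[0, ∞)`. The derivative may blow up at `0`. -/
structure HasLocallyIntegrableDeriv (f f' : ℝ → ℝ) : Prop where
  continuous : Continuous f
  hasDerivAt : ∀ s, 0 < s → HasDerivAt f (f' s) s
  intervalIntegrable : ∀ t, 0 ≤ t → IntervalIntegrable f' volume 0 t

/-- The Wiener integral `∫₀ᵗ f dw` of a function `f` with locally integrable derivative `f'` against
a continuous path `w`, defined by integration by parts. -/
noncomputable def pathIntegral (f f' : ℝ → ℝ) (w : ℝ≥0 → ℝ) (t : ℝ≥0) : ℝ :=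
  f t * w t - f 0 * w 0 - ∫ s in (0 : ℝ)..t, f' s * w s.toNNReal

namespace HasLocallyIntegrableDeriv

variable {f f' g g' : ℝ → ℝ}

lemma sub (hf : HasLocallyIntegrableDeriv f f') (hg : HasLocallyIntegrableDeriv g g') :
    HasLocallyIntegrableDeriv (f - g) (f' - g') where
  continuous := hf.continuous.sub hg.continuous
  hasDerivAt s hs := (hf.hasDerivAt s hs).sub (hg.hasDerivAt s hs)
  intervalIntegrable t ht := (hf.intervalIntegrable t ht).sub (hg.intervalIntegrable t ht)

lemma intervalIntegrable_of_nonneg (hf : HasLocallyIntegrableDeriv f f') {a b : ℝ} (ha : 0 ≤ a)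
    (hab : a ≤ b) : IntervalIntegrable f' volume a b :=
  (hf.intervalIntegrable a ha).symm.trans (hf.intervalIntegrable b (ha.trans hab))

lemma intervalIntegrable_mul (hf : HasLocallyIntegrableDeriv f f') {w : ℝ≥0 → ℝ}
    (hw : Continuous w) {a b : ℝ} (ha : 0 ≤ a) (hab : a ≤ b) :
    IntervalIntegrable (fun s ↦ f' s * w s.toNNReal) volume a b :=
  (hf.intervalIntegrable_of_nonneg ha hab).mul_continuousOn (by fun_prop)

lemma integral_eq_sub (hf : HasLocallyIntegrableDeriv f f') {a b : ℝ} (ha : 0 ≤ a)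
    (hab : a ≤ b) : ∫ s in a..b, f' s = f b - f a :=
  intervalIntegral.integral_eq_sub_of_hasDerivAt_of_le hab hf.continuous.continuousOn
    (fun s hs ↦ hf.hasDerivAt s (ha.trans_lt hs.1)) (hf.intervalIntegrable_of_nonneg ha hab)

lemma pathIntegral_sub (hf : HasLocallyIntegrableDeriv f f') (hg : HasLocallyIntegrableDeriv g g')
    {w : ℝ≥0 → ℝ} (hw : Continuous w) (t : ℝ≥0) :
    pathIntegral (f - g) (f' - g') w t = pathIntegral f f' w t - pathIntegral g g' w t := by
  simp only [pathIntegral, Pi.sub_apply, sub_mul]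
  rw [intervalIntegral.integral_sub (hf.intervalIntegrable_mul hw le_rfl t.coe_nonneg)
    (hg.intervalIntegrable_mul hw le_rfl t.coe_nonneg)]
  ring

lemma continuous_pathIntegral (hf : HasLocallyIntegrableDeriv f f') {w : ℝ≥0 → ℝ}
    (hw : Continuous w) : Continuous (pathIntegral f f' w) := by
  have h1 : Continuous fun t : ℝ≥0 ↦ ∫ s in (0 : ℝ)..t, f' s * w s.toNNReal := by
    rw [continuous_iff_continuousAt]
    intro t
    have hc : ContinuousOn (fun x : ℝ ↦ ∫ s in (0 : ℝ)..x, f' s * w s.toNNReal)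
        (Set.Icc 0 (t + 1)) := by
      have := hf.intervalIntegrable_mul hw le_rfl (show (0 : ℝ) ≤ t + 1 by positivity)
      have h2 := intervalIntegral.continuousOn_primitive_interval (a := (0 : ℝ)) (b := t + 1)
        (μ := volume) (f := fun s ↦ f' s * w s.toNNReal)
        (by rwa [Set.uIcc_of_le (by positivity), integrableOn_Icc_iff_integrableOn_Ioc,
          ← intervalIntegrable_iff_integrableOn_Ioc_of_le (by positivity)])
      rwa [Set.uIcc_of_le (by positivity)] at h2
    refine ContinuousWithinAt.continuousAt (s := Set.Iio (t + 1)) ?_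
      (Iio_mem_nhds (lt_add_one t))
    refine ContinuousWithinAt.comp (t := Set.Icc (0 : ℝ) (t + 1))
      (g := fun x : ℝ ↦ ∫ s in (0 : ℝ)..x, f' s * w s.toNNReal) (f := fun s : ℝ≥0 ↦ (s : ℝ))
      (hc t ⟨t.2, by linarith⟩) (by fun_prop) ?_
    intro s hs
    exact ⟨s.2, by exact_mod_cast (show s < t + 1 from hs).le⟩
  unfold pathIntegral
  have := hf.continuous
  fun_prop

end HasLocallyIntegrableDeriv

/-- The Riemann step function of `f` for the subdivision of `[0, t]` into `k + 1` equal parts, with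
values taken at the left end points. -/
noncomputable def riemannStep (f : ℝ → ℝ) (t : ℝ≥0) (k : ℕ) : StepFun where
  num := k + 1
  pts i := i * t / (k + 1)
  mono i j hij := by
    change (i : ℝ≥0) * t / (k + 1) ≤ (j : ℝ≥0) * t / (k + 1)
    gcongr
  coef i := f (i * t / (k + 1))

section Riemann

variable {f f' : ℝ → ℝ} {t : ℝ≥0} {k : ℕ}

lemma riemannStep_pts_le {i : ℕ} (hi : i ≤ k + 1) : (riemannStep f t k).pts i ≤ t := by
  have hi' : (i : ℝ≥0) ≤ k + 1 := by exact_mod_cast hi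
  change (i : ℝ≥0) * t / (k + 1) ≤ t
  rw [div_le_iff₀ (by positivity), mul_comm]
  gcongr

lemma coe_riemannStep_pts (i : ℕ) : ((riemannStep f t k).pts i : ℝ) = i * t / (k + 1) := by
  simp [riemannStep]

lemma StepFun.eval_eq_coef (h : StepFun) {i : ℕ} (hi : i < h.num) {s : ℝ}
    (hs : s ∈ Set.Ioc (h.pts i : ℝ) (h.pts (i + 1))) : h.eval s = h.coef i := by
  rw [StepFun.eval, Finset.sum_eq_single_of_mem i (Finset.mem_range.2 hi)]
  · exact Set.indicator_of_mem hs _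
  · intro j _ hji
    refine Set.indicator_of_notMem (fun hj ↦ ?_) _
    have hm : Monotone fun i ↦ (h.pts i : ℝ) := fun a b hab ↦ by exact_mod_cast h.mono hab
    exact Set.disjoint_left.1 (hm.pairwise_disjoint_on_Ioc_succ hji) hj hs

lemma exists_riemannStep_eval_eq {s : ℝ} (hs : s ∈ Set.Ioc (0 : ℝ) t) :
    ∃ r ∈ Set.Icc (0 : ℝ) t, |s - r| ≤ t / (k + 1) ∧ (riemannStep f t k).eval s = f r := by
  have ht : (0 : ℝ) < t := hs.1.trans_le hs.2
  have hk : (0 : ℝ) < k + 1 := by positivity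
  set m := ⌈s * (k + 1) / t⌉₊ with hm
  have hpos : 0 < s * (k + 1) / t := div_pos (mul_pos hs.1 hk) ht
  have hm0 : 0 < m := Nat.ceil_pos.2 hpos
  have hmk : m ≤ k + 1 := by
    refine Nat.ceil_le.2 ?_
    rw [div_le_iff₀ ht]
    push_cast
    nlinarith [hs.2]
  obtain ⟨i, hi⟩ : ∃ i, m = i + 1 := ⟨m - 1, by omega⟩
  have h1 : (i : ℝ) * t / (k + 1) < s := by
    have : (i : ℝ) < s * (k + 1) / t := Nat.lt_ceil.1 (by omega)
    rw [lt_div_iff₀ ht] at this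
    rwa [div_lt_iff₀ hk]
  have h2 : s ≤ ((i + 1 : ℕ) : ℝ) * t / (k + 1) := by
    have : s * (k + 1) / t ≤ ((i + 1 : ℕ) : ℝ) := by rw [← hi]; exact Nat.le_ceil _
    rw [div_le_iff₀ ht] at this
    rwa [le_div_iff₀ hk]
  refine ⟨i * t / (k + 1), ⟨by positivity, h1.le.trans hs.2⟩, ?_, ?_⟩
  · rw [abs_of_nonneg (by linarith)]
    have : ((i + 1 : ℕ) : ℝ) * t / (k + 1) = i * t / (k + 1) + t / (k + 1) := by
      push_cast; ring
    linarith
  · refine (StepFun.eval_eq_coef _ (i := i) (by simp only [riemannStep]; omega) ?_).trans rfl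
    rw [coe_riemannStep_pts, coe_riemannStep_pts]
    exact ⟨h1, h2⟩

lemma tendsto_eLpNorm_sub_riemannStep (hf : Continuous f) (t : ℝ≥0) :
    Tendsto (fun k ↦ eLpNorm (fun s ↦ f s - (riemannStep f t k).eval s) 2
      (volume.restrict (Set.Ioc (0 : ℝ) t))) atTop (𝓝 0) := by
  have huc := (isCompact_Icc (a := (0 : ℝ)) (b := t)).uniformContinuousOn_of_continuous
    hf.continuousOn
  rw [Metric.uniformContinuousOn_iff] at huc
  rw [ENNReal.tendsto_nhds_zero]
  intro ε hε
  set C : ℝ≥0∞ := volume.restrict (Set.Ioc (0 : ℝ) t) Set.univ ^ (2 : ℝ≥0∞).toReal⁻¹ with hC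
  have hCtop : C ≠ ∞ := ENNReal.rpow_ne_top_of_nonneg (by positivity) (by simp)
  obtain ⟨δ, hδ, hδε⟩ : ∃ δ : ℝ≥0, 0 < δ ∧ C * δ ≤ ε := by
    rcases ENNReal.exists_nnreal_pos_mul_lt hCtop hε.ne' with ⟨δ, hδ, h⟩
    exact ⟨δ, hδ, by rw [mul_comm]; exact h.le⟩
  obtain ⟨η, hη, hfη⟩ := huc δ (by exact_mod_cast hδ)
  have hlim : Tendsto (fun k : ℕ ↦ (t : ℝ) / (k + 1)) atTop (𝓝 0) :=
    tendsto_const_nhds.div_atTop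
      (tendsto_atTop_add_const_right _ _ tendsto_natCast_atTop_atTop)
  filter_upwards [hlim.eventually (gt_mem_nhds hη)] with k hk
  refine (eLpNorm_le_of_ae_bound (C := δ) ?_).trans ?_
  · rw [ae_restrict_iff' measurableSet_Ioc]
    refine ae_of_all _ fun s hs ↦ ?_
    obtain ⟨r, hr, hsr, he⟩ := exists_riemannStep_eval_eq (f := f) (k := k) hs
    rw [he, ← Real.dist_eq] at *
    exact (hfη s ⟨hs.1.le, hs.2⟩ r hr (by rw [Real.dist_eq]; exact hsr.trans_lt hk)).le
  · rw [ENNReal.ofReal_coe_nnreal]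
    exact hδε

lemma riemannStep_integral_eq {Ω : Type*} (W : ℝ≥0 → Ω → ℝ) (ω : Ω) :
    (riemannStep f t k).integral W t ω =
      ∑ i ∈ Finset.range (k + 1), f (i * t / (k + 1)) *
        (W ((i + 1 : ℕ) * t / (k + 1)) ω - W (i * t / (k + 1)) ω) := by
  refine Finset.sum_congr rfl fun i hi ↦ ?_
  have hi' : i < k + 1 := Finset.mem_range.1 hi
  rw [min_eq_left (riemannStep_pts_le hi'), min_eq_left (riemannStep_pts_le hi'.le)]
  rfl

/-- Summation by parts, with the increments of `f` written as integrals of `f'`. -/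
lemma riemannSum_sub_pathIntegral (hf : HasLocallyIntegrableDeriv f f') {w : ℝ≥0 → ℝ}
    (hw : Continuous w) :
    ∑ i ∈ Finset.range (k + 1), f (i * t / (k + 1)) *
        (w ((i + 1 : ℕ) * t / (k + 1)) - w (i * t / (k + 1))) - pathIntegral f f' w t =
      ∑ i ∈ Finset.range (k + 1), ∫ s in ((i : ℝ) * t / (k + 1))..((i + 1 : ℕ) * t / (k + 1)),
        f' s * (w s.toNNReal - w ((i + 1 : ℕ) * t / (k + 1))) := by
  have hle : ∀ i : ℕ, (i : ℝ) * t / (k + 1) ≤ (i + 1 : ℕ) * t / (k + 1) := fun i ↦ by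
    push_cast; gcongr; linarith
  have h0 : ∀ i : ℕ, 0 ≤ (i : ℝ) * t / (k + 1) := fun i ↦ by positivity
  have hsplit : ∀ i : ℕ, ∫ s in ((i : ℝ) * t / (k + 1))..((i + 1 : ℕ) * t / (k + 1)),
        f' s * (w s.toNNReal - w ((i + 1 : ℕ) * t / (k + 1))) =
      (∫ s in ((i : ℝ) * t / (k + 1))..((i + 1 : ℕ) * t / (k + 1)), f' s * w s.toNNReal) -
        (f ((i + 1 : ℕ) * t / (k + 1)) - f (i * t / (k + 1))) * w ((i + 1 : ℕ) * t / (k + 1)) := by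
    intro i
    simp_rw [mul_sub]
    rw [intervalIntegral.integral_sub (hf.intervalIntegrable_mul hw (h0 i) (hle i))
      ((hf.intervalIntegrable_of_nonneg (h0 i) (hle i)).mul_const _),
      intervalIntegral.integral_mul_const, hf.integral_eq_sub (h0 i) (hle i)]
  have hadj : ∑ i ∈ Finset.range (k + 1),
      ∫ s in ((i : ℝ) * t / (k + 1))..((i + 1 : ℕ) * t / (k + 1)), f' s * w s.toNNReal =
      ∫ s in (0 : ℝ)..t, f' s * w s.toNNReal := by
    rw [intervalIntegral.sum_integral_adjacent_intervals (a := fun i : ℕ ↦ (i : ℝ) * t / (k + 1))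
      fun i _ ↦ hf.intervalIntegrable_mul hw (h0 i) (hle i)]
    have : (k : ℝ) + 1 ≠ 0 := by positivity
    congr 1
    · simp
    · push_cast; field_simp
  have htel := Finset.sum_range_sub
    (fun i : ℕ ↦ f ((i : ℝ) * t / (k + 1)) * w ((i : ℝ≥0) * t / (k + 1))) (k + 1)
  have e1 : ((k + 1 : ℕ) : ℝ) * t / (k + 1) = t := by
    have : (k : ℝ) + 1 ≠ 0 := by positivity
    push_cast; field_simp
  have e2 : ((k + 1 : ℕ) : ℝ≥0) * t / (k + 1) = t := by
    have : (k : ℝ≥0) + 1 ≠ 0 := by positivity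
    push_cast; field_simp
  simp only [e1, e2, Nat.cast_zero, zero_mul, zero_div] at htel
  have hparts : ∑ i ∈ Finset.range (k + 1), f (i * t / (k + 1)) *
        (w ((i + 1 : ℕ) * t / (k + 1)) - w (i * t / (k + 1))) +
      ∑ i ∈ Finset.range (k + 1), (f ((i + 1 : ℕ) * t / (k + 1)) - f (i * t / (k + 1))) *
        w ((i + 1 : ℕ) * t / (k + 1)) = f t * w t - f 0 * w 0 := by
    rw [← htel, ← Finset.sum_add_distrib]
    exact Finset.sum_congr rfl fun i _ ↦ by ring
  simp_rw [hsplit]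
  rw [Finset.sum_sub_distrib, hadj, pathIntegral]
  linarith

/-- The pathwise integral is a limit of Riemann sums: the error is at most the oscillation of `w` at
the scale of the subdivision, times the integral of `|f'|`. -/
lemma tendsto_riemannSum_pathIntegral (hf : HasLocallyIntegrableDeriv f f') {w : ℝ≥0 → ℝ}
    (hw : Continuous w) (t : ℝ≥0) :
    Tendsto (fun k : ℕ ↦ ∑ i ∈ Finset.range (k + 1), f (i * t / (k + 1)) *
        (w ((i + 1 : ℕ) * t / (k + 1)) - w (i * t / (k + 1)))) atTop
      (𝓝 (pathIntegral f f' w t)) := by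
  have huc := (isCompact_Icc (a := (0 : ℝ≥0)) (b := t)).uniformContinuousOn_of_continuous
    hw.continuousOn
  rw [Metric.uniformContinuousOn_iff] at huc
  set I : ℝ := ∫ s in (0 : ℝ)..t, |f' s| with hI
  have hI0 : 0 ≤ I := intervalIntegral.integral_nonneg t.2 fun _ _ ↦ abs_nonneg _
  rw [Metric.tendsto_atTop']
  intro ε hε
  obtain ⟨η, hη, hwη⟩ := huc (ε / (I + 1)) (by positivity)
  have hlim : Tendsto (fun k : ℕ ↦ (t : ℝ) / (k + 1)) atTop (𝓝 0) :=
    tendsto_const_nhds.div_atTop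
      (tendsto_atTop_add_const_right _ _ tendsto_natCast_atTop_atTop)
  obtain ⟨N, hN⟩ := eventually_atTop.1 (hlim.eventually (gt_mem_nhds hη))
  refine ⟨N, fun k hk ↦ ?_⟩
  have hk := hN k hk.le
  rw [Real.dist_eq, riemannSum_sub_pathIntegral hf hw]
  have hle : ∀ i : ℕ, (i : ℝ) * t / (k + 1) ≤ (i + 1 : ℕ) * t / (k + 1) := fun i ↦ by
    push_cast; gcongr; linarith
  have h0 : ∀ i : ℕ, 0 ≤ (i : ℝ) * t / (k + 1) := fun i ↦ by positivity
  have hbound : ∀ i ∈ Finset.range (k + 1),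
      |∫ s in ((i : ℝ) * t / (k + 1))..((i + 1 : ℕ) * t / (k + 1)),
        f' s * (w s.toNNReal - w ((i + 1 : ℕ) * t / (k + 1)))| ≤
      ∫ s in ((i : ℝ) * t / (k + 1))..((i + 1 : ℕ) * t / (k + 1)), ε / (I + 1) * |f' s| := by
    intro i hi
    have hi' : i < k + 1 := Finset.mem_range.1 hi
    rw [← Real.norm_eq_abs]
    refine intervalIntegral.norm_integral_le_of_norm_le (hle i) (ae_of_all _ fun s hs ↦ ?_)
      ((hf.intervalIntegrable_of_nonneg (h0 i) (hle i)).abs.const_mul _)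
    rw [norm_mul, mul_comm, Real.norm_eq_abs (f' s)]
    refine mul_le_mul_of_nonneg_right ?_ (abs_nonneg _)
    have hs0 : 0 ≤ s := (h0 i).trans hs.1.le
    have hti := riemannStep_pts_le (f := f) (t := t) (k := k) (i := i + 1) hi'
    have hti' : ((i + 1 : ℕ) : ℝ≥0) * t / (k + 1) ≤ t := hti
    have hcast : ((((i + 1 : ℕ) : ℝ≥0) * t / (k + 1) : ℝ≥0) : ℝ) = (i + 1 : ℕ) * t / (k + 1) := by
      push_cast; rfl
    have hst : s.toNNReal ≤ ((i + 1 : ℕ) : ℝ≥0) * t / (k + 1) := by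
      rw [← NNReal.coe_le_coe, hcast, Real.coe_toNNReal s hs0]
      exact hs.2
    rw [← dist_eq_norm]
    refine (hwη _ ⟨zero_le, hst.trans hti'⟩ _ ⟨zero_le, hti'⟩ ?_).le
    rw [NNReal.dist_eq, hcast, Real.coe_toNNReal s hs0, abs_sub_comm,
      abs_of_nonneg (by linarith [hs.2])]
    have : ((i + 1 : ℕ) : ℝ) * t / (k + 1) = i * t / (k + 1) + t / (k + 1) := by
      push_cast; ring
    linarith [hs.1]
  refine ((Finset.abs_sum_le_sum_abs _ _).trans (Finset.sum_le_sum hbound)).trans_lt ?_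
  rw [intervalIntegral.sum_integral_adjacent_intervals (a := fun i : ℕ ↦ (i : ℝ) * t / (k + 1))
      fun i _ ↦ ((hf.intervalIntegrable_of_nonneg (h0 i) (hle i)).abs.const_mul _)]
  have e1 : ((k + 1 : ℕ) : ℝ) * t / (k + 1) = t := by
    have : (k : ℝ) + 1 ≠ 0 := by positivity
    push_cast; field_simp
  rw [e1, intervalIntegral.integral_const_mul]
  simp only [Nat.cast_zero, zero_mul, zero_div, ← hI]
  rw [div_mul_eq_mul_div, div_lt_iff₀ (by positivity)]
  nlinarith

end Riemann

/-! ### Wiener integrals against Brownian motions -/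

section WienerIntegral

variable {Ω : Type*} {mΩ : MeasurableSpace Ω} {P : Measure Ω}

/-- A pre-Brownian motion all of whose paths are continuous and all of whose marginals are
measurable, without exceptional null sets. -/
structure IsRegularBrownian (W : ℝ≥0 → Ω → ℝ) (P : Measure Ω) : Prop where
  isPreBrownianReal : IsPreBrownianReal W P
  continuous : ∀ ω, Continuous (W · ω)
  measurable : ∀ t, Measurable (W t)

/-- Every Brownian motion is indistinguishable from a regular one. -/
lemma ProbabilityTheory.IsBrownianReal.exists_isRegularBrownian {B : ℝ≥0 → Ω → ℝ}
    (hB : IsBrownianReal B P) :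
    ∃ W : ℝ≥0 → Ω → ℝ, IsRegularBrownian W P ∧ ∀ᵐ ω ∂P, ∀ t, B t ω = W t ω := by
  classical
  let u := TopologicalSpace.denseSeq ℝ≥0
  have hgood : ∀ᵐ ω ∂P, Continuous (B · ω) ∧
      ∀ k, B (u k) ω = (hB.aemeasurable (u k)).mk _ ω := by
    filter_upwards [hB.cont, ae_all_iff.2 fun k ↦ (hB.aemeasurable (u k)).ae_eq_mk] with ω h1 h2
    exact ⟨h1, h2⟩
  obtain ⟨N, hN, hNm, hN0⟩ := exists_measurable_superset_of_null (ae_iff.1 hgood)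
  have hgood' : ∀ ω ∉ N, Continuous (B · ω) ∧
      ∀ k, B (u k) ω = (hB.aemeasurable (u k)).mk _ ω := by
    intro ω hω
    by_contra h
    exact hω (hN h)
  -- Set the paths to zero on a measurable null set containing the bad event; the resulting marginals
  -- are measurable at dense times, hence at all times by continuity.
  let W : ℝ≥0 → Ω → ℝ := fun t ω ↦ if ω ∈ N then 0 else B t ω
  have hcont : ∀ ω, Continuous (W · ω) := by
    intro ω
    by_cases hω : ω ∈ N
    · simp only [W, if_pos hω]; fun_prop
    · simpa only [W, if_neg hω] using (hgood' ω hω).1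
  have hmu : ∀ k, Measurable (W (u k)) := by
    intro k
    have : W (u k) = fun ω ↦ if ω ∈ N then 0 else (hB.aemeasurable (u k)).mk _ ω := by
      ext ω
      by_cases hω : ω ∈ N
      · simp [W, hω]
      · simp [W, hω, (hgood' ω hω).2 k]
    rw [this]
    exact Measurable.ite hNm measurable_const (hB.aemeasurable (u k)).measurable_mk
  have hae : ∀ᵐ ω ∂P, ∀ t, B t ω = W t ω := by
    have : ∀ᵐ ω ∂P, ω ∉ N := measure_eq_zero_iff_ae_notMem.1 hN0
    filter_upwards [this] with ω hω t
    simp [W, hω]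
  refine ⟨W, ⟨hB.toIsPreBrownianReal.congr fun t ↦ ?_, hcont, fun t ↦ ?_⟩, hae⟩
  · filter_upwards [hae] with ω hω using hω t
  · obtain ⟨v, hv, hvt⟩ := mem_closure_iff_seq_limit.1
      ((TopologicalSpace.denseRange_denseSeq ℝ≥0).closure_range.symm ▸ Set.mem_univ t)
    choose j hj using hv
    refine measurable_of_tendsto_metrizable (f := fun k ↦ W (v k)) (fun k ↦ ?_) ?_
    · rw [← hj k]
      exact hmu (j k)
    · rw [tendsto_pi_nhds]
      exact fun ω ↦ ((hcont ω).tendsto t).comp hvt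

namespace IsRegularBrownian

variable {W : ℝ≥0 → Ω → ℝ} {f f' : ℝ → ℝ}

lemma isProbabilityMeasure (hW : IsRegularBrownian W P) : IsProbabilityMeasure P :=
  hW.isPreBrownianReal.isGaussianProcess.isProbabilityMeasure

lemma measurable_integral (hW : IsRegularBrownian W P) (h : StepFun) (t : ℝ≥0) :
    Measurable (h.integral W t) := by
  unfold StepFun.integral
  have := hW.measurable
  fun_prop

lemma tendsto_riemannStep_integral (hW : IsRegularBrownian W P)
    (hf : HasLocallyIntegrableDeriv f f') (t : ℝ≥0) (ω : Ω) :
    Tendsto (fun k ↦ (riemannStep f t k).integral W t ω) atTop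
      (𝓝 (pathIntegral f f' (W · ω) t)) := by
  simp_rw [riemannStep_integral_eq W ω]
  exact tendsto_riemannSum_pathIntegral hf (hW.continuous ω) t

lemma measurable_pathIntegral (hW : IsRegularBrownian W P)
    (hf : HasLocallyIntegrableDeriv f f') (t : ℝ≥0) :
    Measurable fun ω ↦ pathIntegral f f' (W · ω) t :=
  measurable_of_tendsto_metrizable (fun k ↦ hW.measurable_integral (riemannStep f t k) t)
    (tendsto_pi_nhds.2 (hW.tendsto_riemannStep_integral hf t))

/-- The elementary integrals of the Riemann step functions converge in `L²` to the pathwise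
integral: they are Cauchy by the isometry. -/
lemma tendsto_eLpNorm_pathIntegral_sub (hW : IsRegularBrownian W P)
    (hf : HasLocallyIntegrableDeriv f f') (t : ℝ≥0) :
    Tendsto (fun k ↦ eLpNorm ((fun ω ↦ pathIntegral f f' (W · ω) t) -
      (riemannStep f t k).integral W t) 2 P) atTop (𝓝 0) := by
  refine tendsto_eLpNorm_sub_of_cauchy_of_ae_tendsto
    (fun k ↦ (hW.measurable_integral _ t).aestronglyMeasurable)
    (ae_of_all _ (hW.tendsto_riemannStep_integral hf t))
    (tendsto_eLpNorm_sub_riemannStep hf.continuous t) fun k m ↦ ?_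
  rw [StepFun.eLpNorm_integral_sub hW.isPreBrownianReal]
  have hm : ∀ k, AEStronglyMeasurable (riemannStep f t k).eval
      (volume.restrict (Set.Ioc (0 : ℝ) t)) := fun k ↦ (StepFun.memLp_eval _).1.restrict
  have hfm : AEStronglyMeasurable f (volume.restrict (Set.Ioc (0 : ℝ) t)) :=
    hf.continuous.aestronglyMeasurable
  have : (riemannStep f t m).eval - (riemannStep f t k).eval =
      (fun s ↦ f s - (riemannStep f t k).eval s) - (fun s ↦ f s - (riemannStep f t m).eval s) := by
    ext s; simp
  rw [this, add_comm]
  exact eLpNorm_sub_le (hfm.sub (hm k)) (hfm.sub (hm m)) (by norm_num)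

lemma memLp_pathIntegral (hW : IsRegularBrownian W P)
    (hf : HasLocallyIntegrableDeriv f f') (t : ℝ≥0) :
    MemLp (fun ω ↦ pathIntegral f f' (W · ω) t) 2 P := by
  have hlim := hW.tendsto_eLpNorm_pathIntegral_sub hf t
  obtain ⟨k, hk⟩ := (hlim.eventually (gt_mem_nhds ENNReal.zero_lt_top)).exists
  have h1 : MemLp ((fun ω ↦ pathIntegral f f' (W · ω) t) -
      (riemannStep f t k).integral W t) 2 P :=
    ⟨((hW.measurable_pathIntegral hf t).sub
      (hW.measurable_integral _ t)).aestronglyMeasurable, hk⟩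
  simpa using h1.add (StepFun.memLp_integral hW.isPreBrownianReal.memLp_two (riemannStep f t k) t)

end IsRegularBrownian

lemma eLpNorm_sum_smul_le {E ι : Type*} [NormedAddCommGroup E] [NormedSpace ℝ E] [Fintype ι]
    {Y : ι → Ω → ℝ} (hY : ∀ i, AEStronglyMeasurable (Y i) P) (b : ι → E) {p : ℝ≥0∞}
    (hp : 1 ≤ p) :
    eLpNorm (fun ω ↦ ∑ i, Y i ω • b i) p P ≤ ∑ i, eLpNorm (Y i) p P * ‖b i‖ₑ := by
  have h1 : (fun ω ↦ ∑ i, Y i ω • b i) = ∑ i, fun ω ↦ Y i ω • b i := by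
    ext ω; simp [Finset.sum_apply]
  rw [h1]
  refine (eLpNorm_sum_le (fun i _ ↦ (hY i).smul_const _) hp).trans (Finset.sum_le_sum fun i _ ↦ ?_)
  have : ∀ᵐ ω ∂P, ‖Y i ω • b i‖ ≤ ‖b i‖ * ‖Y i ω‖ :=
    ae_of_all _ fun ω ↦ by rw [norm_smul, mul_comm]
  refine (eLpNorm_le_mul_eLpNorm_of_ae_le_mul this p).trans ?_
  rw [mul_comm, ofReal_norm]

section Representation

variable {E ι : Type*} [NormedAddCommGroup E] [NormedSpace ℝ E] [Fintype ι]
  {X : ℝ≥0 → Ω → E} {W : ι → ℝ≥0 → Ω → ℝ} {b : ι → E} {f f' : ℝ → ℝ}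

lemma StepFun.integral_eq_sum_smul {ω : Ω} (h : StepFun)
    (hX : ∀ t, X t ω - X 0 ω = ∑ i, W i t ω • b i) (t : ℝ≥0) :
    h.integral X t ω = ∑ i, h.integral (W i) t ω • b i := by
  have hinc : ∀ r s, X r ω - X s ω = ∑ i, (W i r ω - W i s ω) • b i := fun r s ↦ by
    rw [← sub_sub_sub_cancel_right (X r ω) (X s ω) (X 0 ω), hX, hX, ← Finset.sum_sub_distrib]
    simp_rw [sub_smul]
  simp_rw [StepFun.integral, hinc, Finset.sum_smul, Finset.smul_sum, smul_smul, smul_eq_mul]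
  exact Finset.sum_comm

lemma tendsto_eLpNorm_sum_smul {κ : Type*} {l : Filter κ} {Y : κ → ι → Ω → ℝ}
    (hY : ∀ k i, AEStronglyMeasurable (Y k i) P)
    (hlim : ∀ i, Tendsto (fun k ↦ eLpNorm (Y k i) 2 P) l (𝓝 0)) (b : ι → E) :
    Tendsto (fun k ↦ eLpNorm (fun ω ↦ ∑ i, Y k i ω • b i) 2 P) l (𝓝 0) := by
  refine tendsto_of_tendsto_of_tendsto_of_le_of_le tendsto_const_nhds ?_ (fun _ ↦ zero_le)
    (fun k ↦ eLpNorm_sum_smul_le (hY k) b (by norm_num))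
  have : ∀ i ∈ Finset.univ, Tendsto (fun k ↦ eLpNorm (Y k i) 2 P * ‖b i‖ₑ) l (𝓝 0) := fun i _ ↦ by
    simpa using ENNReal.Tendsto.mul_const (hlim i) (Or.inr (enorm_ne_top (x := b i)))
  simpa using tendsto_finsetSum _ this

lemma tendsto_eLpNorm_sum_pathIntegral_sub (hW : ∀ i, IsRegularBrownian (W i) P)
    (hX : ∀ᵐ ω ∂P, ∀ t, X t ω - X 0 ω = ∑ i, W i t ω • b i)
    (hf : HasLocallyIntegrableDeriv f f') (t : ℝ≥0) :
    Tendsto (fun k ↦ eLpNorm (fun ω ↦ ∑ i, pathIntegral f f' (W i · ω) t • b i -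
      (riemannStep f t k).integral X t ω) 2 P) atTop (𝓝 0) := by
  have h := tendsto_eLpNorm_sum_smul (b := b) (Y := fun k i ↦
    (fun ω ↦ pathIntegral f f' (W i · ω) t) - (riemannStep f t k).integral (W i) t)
    (fun k i ↦ (((hW i).measurable_pathIntegral hf t).sub
      ((hW i).measurable_integral _ t)).aestronglyMeasurable)
    (fun i ↦ (hW i).tendsto_eLpNorm_pathIntegral_sub hf t)
  refine h.congr fun k ↦ eLpNorm_congr_ae ?_
  filter_upwards [hX] with ω hω
  rw [StepFun.integral_eq_sum_smul _ hω, ← Finset.sum_sub_distrib]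
  simp [sub_smul]

/-- Existence of the Wiener integral. -/
lemma isWienerIntegral_sum_pathIntegral (hW : ∀ i, IsRegularBrownian (W i) P)
    (hX : ∀ᵐ ω ∂P, ∀ t, X t ω - X 0 ω = ∑ i, W i t ω • b i)
    (hf : HasLocallyIntegrableDeriv f f') :
    IsWienerIntegral P X f fun t ω ↦ ∑ i, pathIntegral f f' (W i · ω) t • b i where
  stronglyMeasurable t := Finset.stronglyMeasurable_fun_sum _ fun i _ ↦
    ((hW i).measurable_pathIntegral hf t).stronglyMeasurable.smul_const _
  continuous := ae_of_all _ fun ω ↦ continuous_finsetSum _ fun i _ ↦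
    (hf.continuous_pathIntegral ((hW i).continuous ω)).smul continuous_const
  isLimit t := ⟨riemannStep f t, tendsto_eLpNorm_sub_riemannStep hf.continuous t,
    tendsto_eLpNorm_sum_pathIntegral_sub hW hX hf t⟩

/-- Uniqueness of the Wiener integral. -/
lemma IsWienerIntegral.ae_eq_sum_pathIntegral {G : ℝ≥0 → Ω → E} (hG : IsWienerIntegral P X f G)
    (hW : ∀ i, IsRegularBrownian (W i) P)
    (hX : ∀ᵐ ω ∂P, ∀ t, X t ω - X 0 ω = ∑ i, W i t ω • b i)
    (hf : HasLocallyIntegrableDeriv f f') :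
    ∀ᵐ ω ∂P, ∀ t, G t ω = ∑ i, pathIntegral f f' (W i · ω) t • b i := by
  have hJ := isWienerIntegral_sum_pathIntegral hW hX hf
  have hXm : ∀ (h : StepFun) t, AEStronglyMeasurable (h.integral X t) P := fun h t ↦ by
    refine AEStronglyMeasurable.congr (f := fun ω ↦ ∑ i, h.integral (W i) t ω • b i)
      (Finset.aestronglyMeasurable_fun_sum _ fun i _ ↦
        ((hW i).measurable_integral h t).aestronglyMeasurable.smul_const _) ?_
    filter_upwards [hX] with ω hω
    rw [StepFun.integral_eq_sum_smul _ hω]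
  have hfix : ∀ t, G t =ᵐ[P] fun ω ↦ ∑ i, pathIntegral f f' (W i · ω) t • b i := by
    intro t
    obtain ⟨h, hh, hhG⟩ := hG.isLimit t
    obtain ⟨r, hr, hrJ⟩ := hJ.isLimit t
    set J : Ω → E := fun ω ↦ ∑ i, pathIntegral f f' (W i · ω) t • b i with hJdef
    have hfm : AEStronglyMeasurable f (volume.restrict (Set.Ioc (0 : ℝ) t)) :=
      hf.continuous.aestronglyMeasurable
    have hm : ∀ k : StepFun, AEStronglyMeasurable (fun s ↦ f s - k.eval s)
        (volume.restrict (Set.Ioc (0 : ℝ) t)) :=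
      fun k ↦ hfm.sub (StepFun.memLp_eval k).1.restrict
    -- By the isometry, the integrals of two approximating sequences are asymptotically equal.
    have hstep : Tendsto (fun k ↦ eLpNorm ((r k).eval - (h k).eval) 2
        (volume.restrict (Set.Ioc (0 : ℝ) t))) atTop (𝓝 0) := by
      refine tendsto_of_tendsto_of_tendsto_of_le_of_le tendsto_const_nhds
        (by simpa using hh.add hr) (fun _ ↦ zero_le) fun k ↦ ?_
      have : (r k).eval - (h k).eval = (fun s ↦ f s - (h k).eval s) -
          (fun s ↦ f s - (r k).eval s) := by ext s; simp
      rw [this]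
      exact eLpNorm_sub_le (hm _) (hm _) (by norm_num)
    have hdiff : Tendsto (fun k ↦ eLpNorm ((r k).integral X t - (h k).integral X t) 2 P) atTop
        (𝓝 0) := by
      have := tendsto_eLpNorm_sum_smul (P := P) (b := b) (Y := fun k i ↦
        (r k).integral (W i) t - (h k).integral (W i) t)
        (fun k i ↦ (((hW i).measurable_integral _ t).sub
          ((hW i).measurable_integral _ t)).aestronglyMeasurable)
        (fun i ↦ by simpa only [StepFun.eLpNorm_integral_sub (hW i).isPreBrownianReal] using hstep)
      refine this.congr fun k ↦ eLpNorm_congr_ae ?_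
      filter_upwards [hX] with ω hω
      simp [StepFun.integral_eq_sum_smul _ hω, sub_smul]
    have hzero : eLpNorm (G t - J) 2 P ≤ 0 := by
      refine ge_of_tendsto' (f := fun k ↦ eLpNorm (fun ω ↦ G t ω - (h k).integral X t ω) 2 P +
        eLpNorm ((r k).integral X t - (h k).integral X t) 2 P +
        eLpNorm (fun ω ↦ J ω - (r k).integral X t ω) 2 P) (x := atTop)
        (by simpa using (hhG.add hdiff).add hrJ) fun k ↦ ?_
      have hG' := (hG.stronglyMeasurable t).aestronglyMeasurable (μ := P)
      have hJ' := (hJ.stronglyMeasurable t).aestronglyMeasurable (μ := P)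
      have : G t - J = (G t - (h k).integral X t - ((r k).integral X t - (h k).integral X t)) -
          (J - (r k).integral X t) := by ext ω; simp
      rw [this]
      refine (eLpNorm_sub_le ((hG'.sub (hXm _ t)).sub ((hXm _ t).sub (hXm _ t)))
        (hJ'.sub (hXm _ t)) (by norm_num)).trans ?_
      gcongr
      · exact eLpNorm_sub_le (hG'.sub (hXm _ t)) ((hXm _ t).sub (hXm _ t)) (by norm_num)
      · rfl
    rw [nonpos_iff_eq_zero, eLpNorm_eq_zero_iff ((hG.stronglyMeasurable t).sub
      (hJ.stronglyMeasurable t)).aestronglyMeasurable (by norm_num)] at hzero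
    filter_upwards [hzero] with ω hω
    exact sub_eq_zero.1 hω
  -- Two continuous paths which agree at countably many dense times are equal.
  filter_upwards [hG.continuous, hJ.continuous,
    ae_all_iff.2 fun k ↦ hfix (TopologicalSpace.denseSeq ℝ≥0 k)] with ω h1 h2 h3
  refine congrFun (h1.ext_on (TopologicalSpace.denseRange_denseSeq ℝ≥0) h2 ?_)
  rintro _ ⟨k, rfl⟩
  exact h3 k

lemma isWienerIntegral_wienerIntegral (hW : ∀ i, IsRegularBrownian (W i) P)
    (hX : ∀ᵐ ω ∂P, ∀ t, X t ω - X 0 ω = ∑ i, W i t ω • b i)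
    (hf : HasLocallyIntegrableDeriv f f') :
    IsWienerIntegral P X f (wienerIntegral P X f) := by
  have h : ∃ G, IsWienerIntegral P X f G := ⟨_, isWienerIntegral_sum_pathIntegral hW hX hf⟩
  rw [wienerIntegral, dif_pos h]
  exact h.choose_spec

end Representation

end WienerIntegral

/-! ### Limits of Gaussian processes -/

section GaussianLimit

variable {Ω : Type*} {mΩ : MeasurableSpace Ω} {P : Measure Ω}

lemma covariance_congr_ae {X X' Y Y' : Ω → ℝ} (hX : X =ᵐ[P] X') (hY : Y =ᵐ[P] Y') :
    cov[X, Y; P] = cov[X', Y'; P] := by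
  rw [covariance, covariance, integral_congr_ae hX, integral_congr_ae hY]
  refine integral_congr_ae ?_
  filter_upwards [hX, hY] with ω h1 h2
  rw [h1, h2]

lemma norm_exp_mul_I_sub_exp_mul_I_le (a b : ℝ) :
    ‖Complex.exp (a * Complex.I) - Complex.exp (b * Complex.I)‖ ≤ ‖a - b‖ := by
  have : Complex.exp (a * Complex.I) - Complex.exp (b * Complex.I) =
      Complex.exp (b * Complex.I) * (Complex.exp (Complex.I * ((a - b : ℝ) : ℂ)) - 1) := by
    rw [mul_sub, ← Complex.exp_add]
    push_cast
    ring_nf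
  rw [this, norm_mul, Complex.norm_exp_ofReal_mul_I, one_mul]
  exact Real.norm_exp_I_mul_ofReal_sub_one_le

/-- The Gaussian form of the characteristic function at `1` is preserved by `L²` limits. -/
lemma integral_exp_mul_I_eq_of_tendsto_eLpNorm [IsProbabilityMeasure P] {U : ℕ → Ω → ℝ} {V : Ω → ℝ}
    (hU : ∀ k, MemLp (U k) 2 P) (hV : MemLp V 2 P)
    (hlim : Tendsto (fun k ↦ eLpNorm (U k - V) 2 P) atTop (𝓝 0))
    (h : ∀ k, ∫ ω, Complex.exp (U k ω * Complex.I) ∂P =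
      Complex.exp ((P[U k] : ℝ) * Complex.I - Var[U k; P] / 2)) :
    ∫ ω, Complex.exp (V ω * Complex.I) ∂P =
      Complex.exp ((P[V] : ℝ) * Complex.I - Var[V; P] / 2) := by
  have hmeas : ∀ {Y : Ω → ℝ}, MemLp Y 2 P →
      AEStronglyMeasurable (fun ω ↦ Complex.exp (Y ω * Complex.I)) P := fun {Y} hY ↦
    (by fun_prop : Continuous fun y : ℝ ↦ Complex.exp (y * Complex.I)).comp_aestronglyMeasurable
      hY.1
  have hbd : ∀ {Y : Ω → ℝ}, MemLp Y 2 P →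
      Integrable (fun ω ↦ Complex.exp (Y ω * Complex.I)) P := fun {Y} hY ↦
    (integrable_const (1 : ℝ)).mono' (hmeas hY) (ae_of_all _ fun ω ↦ by
      rw [Complex.norm_exp_ofReal_mul_I])
  have h1 : Tendsto (fun k ↦ ∫ ω, Complex.exp (U k ω * Complex.I) ∂P) atTop
      (𝓝 (∫ ω, Complex.exp (V ω * Complex.I) ∂P)) := by
    refine tendsto_integral_of_L1' _ (hmeas hV) (Eventually.of_forall fun k ↦ hbd (hU k)) ?_
    refine tendsto_of_tendsto_of_tendsto_of_le_of_le tendsto_const_nhds hlim (fun _ ↦ zero_le)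
      fun k ↦ ?_
    refine le_trans (eLpNorm_mono fun ω ↦ ?_)
      (eLpNorm_le_eLpNorm_of_exponent_le one_le_two ((hU k).sub hV).1)
    exact norm_exp_mul_I_sub_exp_mul_I_le _ _
  have hmean := tendsto_integral_of_tendsto_eLpNorm_two hU hV hlim
  have hvar : Tendsto (fun k ↦ Var[U k; P]) atTop (𝓝 Var[V; P]) := by
    have h2 := tendsto_integral_mul_of_tendsto_eLpNorm hU hU hV hV hlim hlim
    simp_rw [variance_eq_sub (hU _), variance_eq_sub hV, Pi.pow_apply, pow_two]
    exact h2.sub (hmean.mul hmean)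
  have h3 : Tendsto (fun k ↦ Complex.exp ((P[U k] : ℝ) * Complex.I - Var[U k; P] / 2)) atTop
      (𝓝 (Complex.exp ((P[V] : ℝ) * Complex.I - Var[V; P] / 2))) := by
    exact (((Complex.continuous_ofReal.tendsto _).comp hmean).mul_const _ |>.sub
      (((Complex.continuous_ofReal.tendsto _).comp hvar).div_const _)).cexp
  simp_rw [h] at h1
  exact tendsto_nhds_unique h1 h3

/-- An `L²` limit of real Gaussian processes is a Gaussian process. -/
lemma ProbabilityTheory.IsGaussianProcess.of_tendsto_eLpNorm {S : Type*} {Y : ℕ → S → Ω → ℝ}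
    {Z : S → Ω → ℝ} (hY : ∀ k, IsGaussianProcess (Y k) P) (hZ : ∀ s, MemLp (Z s) 2 P)
    (hlim : ∀ s, Tendsto (fun k ↦ eLpNorm (Y k s - Z s) 2 P) atTop (𝓝 0)) :
    IsGaussianProcess Z P where
  hasGaussianLaw I := by
    have := (hY 0).isProbabilityMeasure
    have hae : AEMeasurable (fun ω ↦ I.restrict (Z · ω)) P :=
      aemeasurable_pi_lambda _ fun s ↦ (hZ s).1.aemeasurable
    have hYm : ∀ k s, MemLp (Y k s) 2 P := fun k s ↦ ((hY k).hasGaussianLaw_eval s).memLp_two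
    rw [hasGaussianLaw_iff_charFunDual_map_eq hae]
    intro L
    classical
    have hL : ∀ x : I → ℝ, L x = ∑ s, x s • L (Pi.single s 1) := fun x ↦ by
      conv_lhs => rw [← Finset.univ_sum_single x, map_sum]
      refine Finset.sum_congr rfl fun s _ ↦ ?_
      rw [← map_smul, ← Pi.single_smul, smul_eq_mul, mul_one]
    have hLZ : (fun ω ↦ L (I.restrict (Z · ω))) =
        fun ω ↦ ∑ s : I, Z s ω • L (Pi.single s 1) := by
      ext ω; simp [hL (I.restrict (Z · ω))]
    have hLY : ∀ k, (fun ω ↦ L (I.restrict (Y k · ω))) =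
        fun ω ↦ ∑ s : I, Y k s ω • L (Pi.single s 1) := fun k ↦ by
      ext ω; simp [hL (I.restrict (Y k · ω))]
    rw [charFunDual_apply, integral_map hae (by fun_prop)]
    refine integral_exp_mul_I_eq_of_tendsto_eLpNorm
      (U := fun k ω ↦ L (I.restrict (Y k · ω))) (fun k ↦ ?_) ?_ ?_ fun k ↦ ?_
    · rw [hLY]
      exact memLp_finsetSum _ fun s _ ↦ (hYm k s).mul_const _
    · rw [hLZ]
      exact memLp_finsetSum _ fun s _ ↦ (hZ s).mul_const _
    · have := tendsto_eLpNorm_sum_smul (P := P) (l := atTop) (ι := I)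
        (Y := fun k s ↦ Y k s - Z s) (fun k s ↦ ((hYm k s).sub (hZ s)).1) (fun s ↦ hlim s)
        (fun s ↦ L (Pi.single s 1))
      refine this.congr fun k ↦ ?_
      rw [hLY, hLZ]
      congr 1
      ext ω
      simp [sub_mul]
    · have hg := (hY k).hasGaussianLaw I
      have := hg.charFunDual_map_eq L
      rwa [charFunDual_apply, integral_map hg.aemeasurable (by fun_prop)] at this

lemma isGaussianProcess_of_iIndepFun {ι T : Type*} [Fintype ι] {W : ι → T → Ω → ℝ}
    (hW : ∀ i, IsGaussianProcess (W i) P) (hind : iIndepFun (fun i ω t ↦ W i t ω) P) :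
    IsGaussianProcess (fun (p : ι × T) ω ↦ W p.1 p.2 ω) P where
  hasGaussianLaw I := by
    classical
    let J : Finset T := I.image Prod.snd
    have hJ : HasGaussianLaw (fun ω (i : ι) ↦ J.restrict (W i · ω)) P :=
      iIndepFun.hasGaussianLaw (X := fun i ω ↦ J.restrict (W i · ω))
        (fun i ↦ (hW i).hasGaussianLaw J)
        (hind.comp (fun _ x ↦ J.restrict x) fun _ ↦ Finset.measurable_restrict J)
    let L : (ι → J → ℝ) →L[ℝ] (I → ℝ) :=
      { toFun := fun x p ↦ x p.1.1 ⟨p.1.2, Finset.mem_image_of_mem _ p.2⟩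
        map_add' := fun x y ↦ by ext; simp
        map_smul' := fun c x ↦ by ext; simp }
    exact hJ.map L

end GaussianLimit

/-! ### Wiener integrals against independent Brownian motions -/

section Joint

variable {Ω : Type*} {mΩ : MeasurableSpace Ω} {P : Measure Ω} {ι : Type*}
  {W : ι → ℝ≥0 → Ω → ℝ} {f f' : ℝ → ℝ}

lemma StepFun.isGaussianProcess_integral {S : Type*} (h : S → StepFun) (t : S → ℝ≥0) (i : S → ι)
    (hW : IsGaussianProcess (fun (p : ι × ℝ≥0) ω ↦ W p.1 p.2 ω) P) :
    IsGaussianProcess (fun s ↦ (h s).integral (W (i s)) (t s)) P := by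
  refine hW.of_isGaussianProcess fun s ↦ ?_
  let c := (h s).stoppedCoeff (t s)
  let I : Finset (ι × ℝ≥0) := c.support.map ⟨fun a ↦ (i s, a), fun a b hab ↦ (Prod.ext_iff.1 hab).2⟩
  have hI : ∀ a : c.support, (i s, a.1) ∈ I := fun a ↦ Finset.mem_map.2 ⟨a, a.2, rfl⟩
  let L : (I → ℝ) →L[ℝ] ℝ := ∑ a : c.support, c a • ContinuousLinearMap.proj ⟨(i s, a.1), hI a⟩
  refine ⟨I, L, fun ω ↦ ?_⟩
  rw [← StepFun.linearCombination_stoppedCoeff, Finsupp.linearCombination_apply, Finsupp.sum,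
    Finset.sum_apply, ← Finset.sum_coe_sort]
  simp [L, c]

/-- The pathwise integrals of `f` against independent Brownian motions form a Gaussian process. -/
lemma isGaussianProcess_pathIntegral [Fintype ι] (hW : ∀ i, IsRegularBrownian (W i) P)
    (hind : iIndepFun (fun i ω t ↦ W i t ω) P) (hf : HasLocallyIntegrableDeriv f f') :
    IsGaussianProcess (fun (p : ι × ℝ≥0) ω ↦ pathIntegral f f' (W p.1 · ω) p.2) P := by
  refine IsGaussianProcess.of_tendsto_eLpNorm
    (Y := fun k p ↦ (riemannStep f p.2 k).integral (W p.1) p.2)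
    (fun k ↦ StepFun.isGaussianProcess_integral (fun p ↦ riemannStep f p.2 k) Prod.snd Prod.fst
      (isGaussianProcess_of_iIndepFun
        (fun i ↦ IsPreBrownianReal.isGaussianProcess (hW i).isPreBrownianReal) hind))
    (fun p ↦ (hW p.1).memLp_pathIntegral hf p.2) fun p ↦ ?_
  refine ((hW p.1).tendsto_eLpNorm_pathIntegral_sub hf p.2).congr fun k ↦ ?_
  exact eLpNorm_sub_comm _ _ _ _

lemma StepFun.integral_integral_eq_zero {V : ℝ≥0 → Ω → ℝ} (hV : IsPreBrownianReal V P)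
    (h : StepFun) (t : ℝ≥0) : ∫ ω, h.integral V t ω ∂P = 0 := by
  unfold StepFun.integral
  rw [integral_finsetSum]
  · refine Finset.sum_eq_zero fun i _ ↦ ?_
    rw [integral_smul, integral_sub (hV.integrable_eval _) (hV.integrable_eval _),
      hV.integral_eval, hV.integral_eval]
    simp
  · exact fun i _ ↦ ((hV.integrable_eval _).sub (hV.integrable_eval _)).const_mul _

lemma IsRegularBrownian.integral_pathIntegral_eq_zero {V : ℝ≥0 → Ω → ℝ}
    (hV : IsRegularBrownian V P) (hf : HasLocallyIntegrableDeriv f f') (t : ℝ≥0) :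
    ∫ ω, pathIntegral f f' (V · ω) t ∂P = 0 := by
  have := hV.isProbabilityMeasure
  have hlim := (hV.tendsto_eLpNorm_pathIntegral_sub hf t).congr fun k ↦ eLpNorm_sub_comm _ _ _ _
  have h := tendsto_integral_of_tendsto_eLpNorm_two
    (fun k ↦ StepFun.memLp_integral hV.isPreBrownianReal.memLp_two _ t)
    (hV.memLp_pathIntegral hf t) hlim
  simp_rw [StepFun.integral_integral_eq_zero hV.isPreBrownianReal] at h
  exact tendsto_nhds_unique h tendsto_const_nhds |>.trans rfl

lemma memLp_indicator_Ioc (hf : Continuous f) (t : ℝ≥0) :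
    MemLp ((Set.Ioc (0 : ℝ) t).indicator f) 2 volume := by
  rw [memLp_indicator_iff_restrict measurableSet_Ioc]
  rw [memLp_two_iff_integrable_sq hf.aestronglyMeasurable]
  exact ((hf.pow 2).continuousOn.integrableOn_compact isCompact_Icc).mono_set
    Set.Ioc_subset_Icc_self

/-- The Itô isometry for the pathwise integrals. -/
lemma covariance_pathIntegral [DecidableEq ι] (hW : ∀ i, IsRegularBrownian (W i) P)
    (hind : iIndepFun (fun i ω t ↦ W i t ω) P) (hf : HasLocallyIntegrableDeriv f f') (i j : ι)
    (s t : ℝ≥0) :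
    cov[fun ω ↦ pathIntegral f f' (W i · ω) s, fun ω ↦ pathIntegral f f' (W j · ω) t; P] =
      if i = j then ∫ x in (0 : ℝ)..(min s t : ℝ≥0), f x ^ 2 else 0 := by
  have := (hW i).isProbabilityMeasure
  have hlim := fun i t ↦ ((hW i).tendsto_eLpNorm_pathIntegral_sub hf t).congr
    fun k ↦ eLpNorm_sub_comm _ _ _ _
  rw [covariance_eq_sub ((hW i).memLp_pathIntegral hf s) ((hW j).memLp_pathIntegral hf t),
    (hW i).integral_pathIntegral_eq_zero hf, (hW j).integral_pathIntegral_eq_zero hf, mul_zero,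
    sub_zero]
  have h := tendsto_integral_mul_of_tendsto_eLpNorm
    (fun k ↦ StepFun.memLp_integral (hW i).isPreBrownianReal.memLp_two _ s)
    (fun k ↦ StepFun.memLp_integral (hW j).isPreBrownianReal.memLp_two _ t)
    ((hW i).memLp_pathIntegral hf s) ((hW j).memLp_pathIntegral hf t) (hlim i s) (hlim j t)
  split_ifs with hij
  · subst hij
    have hstep : ∀ t : ℝ≥0, Tendsto (fun k ↦ eLpNorm ((Set.Ioc (0 : ℝ) t).indicator
        (riemannStep f t k).eval - (Set.Ioc (0 : ℝ) t).indicator f) 2 volume) atTop (𝓝 0) := by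
      intro t
      refine (tendsto_eLpNorm_sub_riemannStep hf.continuous t).congr fun k ↦ ?_
      rw [← Set.indicator_sub', eLpNorm_indicator_eq_eLpNorm_restrict measurableSet_Ioc,
        eLpNorm_sub_comm]
      rfl
    have h' := tendsto_integral_mul_of_tendsto_eLpNorm
      (fun k ↦ (StepFun.memLp_eval (riemannStep f s k)).indicator (measurableSet_Ioc (b := (s : ℝ))))
      (fun k ↦ (StepFun.memLp_eval (riemannStep f t k)).indicator (measurableSet_Ioc (b := (t : ℝ))))
      (memLp_indicator_Ioc hf.continuous s) (memLp_indicator_Ioc hf.continuous t)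
      (hstep s) (hstep t)
    simp_rw [StepFun.integral_integral_mul_integral (hW i).isPreBrownianReal] at h
    refine (tendsto_nhds_unique h h').trans ?_
    simp_rw [← Set.inter_indicator_mul, Set.Ioc_inter_Ioc]
    rw [integral_indicator measurableSet_Ioc, intervalIntegral.integral_of_le (by positivity)]
    simp [pow_two]
  · have hind2 : ∀ s t, IndepFun (W i s) (W j t) P := fun s t ↦
      (hind.indepFun hij).comp (measurable_pi_apply s) (measurable_pi_apply t)
    simp_rw [StepFun.integral_integral_mul_integral_of_indepFun (hW i).isPreBrownianReal
      (hW j).isPreBrownianReal hind2] at h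
    exact (tendsto_nhds_unique h tendsto_const_nhds)

end Joint

/-! ### The Gaussian martingale property -/

section Martingale

variable {Ω : Type*} {mΩ : MeasurableSpace Ω} {P : Measure Ω} {ι : Type*} [Fintype ι]
  {W : ι → ℝ≥0 → Ω → ℝ} {f f' : ℝ → ℝ}
  {E : Type*} [NormedAddCommGroup E] [InnerProductSpace ℝ E] [CompleteSpace E]
  [SecondCountableTopology E] [MeasurableSpace E] [BorelSpace E] {b : ι → E} {H : ℝ≥0 → Ω → E}

omit [CompleteSpace E] in
lemma isGaussianProcess_of_ae_eq_sum_pathIntegral (hW : ∀ i, IsRegularBrownian (W i) P)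
    (hind : iIndepFun (fun i ω t ↦ W i t ω) P) (hf : HasLocallyIntegrableDeriv f f')
    (hH : ∀ t, H t =ᵐ[P] fun ω ↦ ∑ i, pathIntegral f f' (W i · ω) t • b i) :
    IsGaussianProcess H P := by
  refine IsGaussianProcess.congr (X := fun t ω ↦ ∑ i, pathIntegral f f' (W i · ω) t • b i)
    (IsGaussianProcess.of_isGaussianProcess (isGaussianProcess_pathIntegral hW hind hf) fun t ↦ ?_)
    fun t ↦ (hH t).symm
  let I : Finset (ι × ℝ≥0) := Finset.univ.map ⟨fun i ↦ (i, t), fun i j hij ↦ (Prod.ext_iff.1 hij).1⟩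
  have hI : ∀ i, (i, t) ∈ I := fun i ↦ Finset.mem_map.2 ⟨i, Finset.mem_univ _, rfl⟩
  let L : (I → ℝ) →L[ℝ] E := ∑ i, (ContinuousLinearMap.proj (R := ℝ) (φ := fun _ : I ↦ ℝ)
    (⟨(i, t), hI i⟩ : I)).smulRight (b i)
  exact ⟨I, L, fun ω ↦ by simp [L]⟩

omit [SecondCountableTopology E] [MeasurableSpace E] [BorelSpace E] in
lemma integral_eq_zero_of_ae_eq_sum_pathIntegral (hW : ∀ i, IsRegularBrownian (W i) P)
    (hf : HasLocallyIntegrableDeriv f f') {t : ℝ≥0}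
    (hH : H t =ᵐ[P] fun ω ↦ ∑ i, pathIntegral f f' (W i · ω) t • b i) :
    ∫ ω, H t ω ∂P = 0 := by
  rw [integral_congr_ae hH]
  by_cases hι : Nonempty ι
  · have : IsProbabilityMeasure P := (hW hι.some).isProbabilityMeasure
    rw [integral_finsetSum _ fun i _ ↦
      (((hW i).memLp_pathIntegral hf t).integrable (by norm_num)).smul_const _]
    refine Finset.sum_eq_zero fun i _ ↦ ?_
    rw [integral_smul_const, (hW i).integral_pathIntegral_eq_zero hf, zero_smul]
  · have : IsEmpty ι := not_nonempty_iff.1 hι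
    simp

omit [Fintype ι] in
/-- The Wiener integrals have orthogonal increments. -/
lemma covariance_pathIntegral_sub_eq_zero (hW : ∀ i, IsRegularBrownian (W i) P)
    (hind : iIndepFun (fun i ω t ↦ W i t ω) P) (hf : HasLocallyIntegrableDeriv f f') (i j : ι)
    {r s t : ℝ≥0} (hrs : r ≤ s) (hst : s ≤ t) :
    cov[fun ω ↦ pathIntegral f f' (W i · ω) t - pathIntegral f f' (W i · ω) s,
      fun ω ↦ pathIntegral f f' (W j · ω) r; P] = 0 := by
  classical
  have := (hW i).isProbabilityMeasure
  rw [covariance_fun_sub_left ((hW i).memLp_pathIntegral hf t) ((hW i).memLp_pathIntegral hf s)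
    ((hW j).memLp_pathIntegral hf r), covariance_pathIntegral hW hind hf,
    covariance_pathIntegral hW hind hf, min_eq_right (hrs.trans hst), min_eq_right hrs, sub_self]

/-- A linear combination, with vector coefficients, of Wiener integrals of the same function against
independent Brownian motions is a martingale for its natural filtration: the increments are
independent of the past, since they are uncorrelated with it. -/
lemma martingale_of_ae_eq_sum_pathIntegral (hW : ∀ i, IsRegularBrownian (W i) P)
    (hind : iIndepFun (fun i ω t ↦ W i t ω) P) (hf : HasLocallyIntegrableDeriv f f')
    (hm : ∀ t, StronglyMeasurable (H t))
    (hH : ∀ t, H t =ᵐ[P] fun ω ↦ ∑ i, pathIntegral f f' (W i · ω) t • b i) :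
    Martingale H (Filtration.natural H hm) P := by
  classical
  have hG := isGaussianProcess_of_ae_eq_sum_pathIntegral hW hind hf hH
  have := hG.isProbabilityMeasure
  have hint : ∀ t, Integrable (H t) P := fun t ↦ (hG.hasGaussianLaw_eval t).integrable
  refine ⟨Filtration.stronglyAdapted_natural hm, fun s t hst ↦ ?_⟩
  -- The increment and the past are both seen as processes, since the independence criterion for
  -- jointly Gaussian processes applies to families.
  let D : Unit → Ω → E := fun _ ω ↦ H t ω - H s ω
  let Y : Set.Iic s → Ω → E := fun r ↦ H r
  have hDY : IndepFun (fun ω u ↦ D u ω) (fun ω r ↦ Y r ω) P := by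
    refine IsGaussianProcess.indepFun_of_covariance_inner ?_
      (fun _ ↦ ((hm t).sub (hm s)).measurable.aemeasurable)
      (fun r ↦ (hm r).measurable.aemeasurable) fun _ r x y ↦ ?_
    · refine hG.of_isGaussianProcess ?_
      rintro (_ | r)
      · exact ⟨{t, s},
          { toFun := fun x ↦ x ⟨t, by simp⟩ - x ⟨s, by simp⟩
            map_add' := fun x y ↦ by simp; abel
            map_smul' := fun c x ↦ by simp [smul_sub] }, fun ω ↦ by simp [D]⟩
      · exact ⟨{r.1},
          { toFun := fun x ↦ x ⟨r.1, by simp⟩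
            map_add' := fun x y ↦ by simp
            map_smul' := fun c x ↦ by simp }, fun ω ↦ by simp [Y]⟩
    · have h1 : (fun ω ↦ inner ℝ x (D () ω)) =ᵐ[P] fun ω ↦ ∑ i, inner ℝ x (b i) *
          (pathIntegral f f' (W i · ω) t - pathIntegral f f' (W i · ω) s) := by
        filter_upwards [hH t, hH s] with ω ht hs
        simp only [D, ht, hs, inner_sub_right, inner_sum, inner_smul_right,
          ← Finset.sum_sub_distrib]
        exact Finset.sum_congr rfl fun i _ ↦ by ring
      have h2 : (fun ω ↦ inner ℝ y (Y r ω)) =ᵐ[P] fun ω ↦ ∑ i, inner ℝ y (b i) *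
          pathIntegral f f' (W i · ω) r := by
        filter_upwards [hH r] with ω hr
        simp only [Y, hr, inner_sum, inner_smul_right]
        exact Finset.sum_congr rfl fun i _ ↦ by ring
      have h3 : ∀ i, MemLp (fun ω ↦ inner ℝ x (b i) *
          (pathIntegral f f' (W i · ω) t - pathIntegral f f' (W i · ω) s)) 2 P := fun i ↦
        (((hW i).memLp_pathIntegral hf t).sub ((hW i).memLp_pathIntegral hf s)).const_mul _
      rw [covariance_congr_ae h1 h2, covariance_fun_sum_fun_sum h3
        (fun i ↦ ((hW i).memLp_pathIntegral hf r).const_mul _)]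
      refine Finset.sum_eq_zero fun i _ ↦ Finset.sum_eq_zero fun j _ ↦ ?_
      rw [covariance_const_mul_left, covariance_const_mul_right,
        covariance_pathIntegral_sub_eq_zero hW hind hf i j r.2 hst, mul_zero, mul_zero]
  have hle : Filtration.natural H hm s ≤ MeasurableSpace.comap (fun ω r ↦ Y r ω) inferInstance := by
    refine iSup₂_le fun r hr ↦ ?_
    have : H r = (fun y ↦ y ⟨r, hr⟩) ∘ fun ω (r : Set.Iic s) ↦ Y r ω := rfl
    rw [this, ← MeasurableSpace.comap_comp]
    exact MeasurableSpace.comap_mono (measurable_pi_apply _).comap_le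
  have hDm : Measurable[MeasurableSpace.comap (fun ω u ↦ D u ω) inferInstance] (D ()) :=
    (measurable_pi_apply (X := fun _ : Unit ↦ E) ()).comp
      (comap_measurable fun ω (u : Unit) ↦ D u ω)
  have hcond : P[D () | Filtration.natural H hm s] =ᵐ[P] fun _ ↦ ∫ ω, D () ω ∂P :=
    condExp_indep_eq (m₁ := MeasurableSpace.comap (fun ω u ↦ D u ω) inferInstance)
      (measurable_pi_lambda _ fun _ ↦ ((hm t).sub (hm s)).measurable).comap_le
      (Filtration.le _ s) hDm.stronglyMeasurable (indep_of_indep_of_le_right hDY hle)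
  have hD0 : ∫ ω, D () ω ∂P = 0 := by
    rw [integral_sub (hint t) (hint s), integral_eq_zero_of_ae_eq_sum_pathIntegral hW hf (hH t),
      integral_eq_zero_of_ae_eq_sum_pathIntegral hW hf (hH s), sub_zero]
  have hs : P[H s | Filtration.natural H hm s] = H s :=
    condExp_of_stronglyMeasurable (Filtration.le _ s) (Filtration.stronglyAdapted_natural hm s)
      (hint s)
  have hsplit : H t = D () + H s := by ext ω; simp [D]
  have hadd := condExp_add (μ := P) ((hint t).sub (hint s)) (hint s) (Filtration.natural H hm s)
  rw [hsplit]
  filter_upwards [hadd, hcond] with ω h1 h2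
  rw [hs] at h1
  change (P[D () + H s | Filtration.natural H hm s]) ω = _ at h1
  rw [h1, Pi.add_apply]
  change (P[D () | Filtration.natural H hm s]) ω + _ = _
  rw [h2, hD0, zero_add]

end Martingale

/-! ### The limit of the Wiener integrals -/

section Limit

variable {Ω : Type*} {mΩ : MeasurableSpace Ω} {P : Measure Ω} {ι : Type*}
  {W : ι → ℝ≥0 → Ω → ℝ} {f f' : ℝ → ℝ}

lemma eLpNorm_pathIntegral_sub_pathIntegral (hW : ∀ i, IsRegularBrownian (W i) P)
    (hind : iIndepFun (fun i ω t ↦ W i t ω) P) (hf : HasLocallyIntegrableDeriv f f') (i : ι)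
    {s t : ℝ≥0} (hst : s ≤ t) :
    eLpNorm ((fun ω ↦ pathIntegral f f' (W i · ω) t) - fun ω ↦ pathIntegral f f' (W i · ω) s) 2 P =
      ENNReal.ofReal √((∫ x in (0 : ℝ)..t, f x ^ 2) - ∫ x in (0 : ℝ)..s, f x ^ 2) := by
  classical
  have := (hW i).isProbabilityMeasure
  have ht := (hW i).memLp_pathIntegral hf t
  have hs := (hW i).memLp_pathIntegral hf s
  rw [eLpNorm_two_eq_ofReal_sqrt (ht.sub hs)]
  congr 2
  have h := covariance_eq_sub (ht.sub hs) (ht.sub hs)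
  have h0 : ∫ ω, ((fun ω ↦ pathIntegral f f' (W i · ω) t) -
      fun ω ↦ pathIntegral f f' (W i · ω) s) ω ∂P = 0 := by
    simp_rw [Pi.sub_apply]
    rw [integral_sub (ht.integrable (by norm_num)) (hs.integrable (by norm_num)),
      (hW i).integral_pathIntegral_eq_zero hf, (hW i).integral_pathIntegral_eq_zero hf, sub_zero]
  rw [h0, mul_zero, sub_zero] at h
  rw [show (fun x ↦ ((fun ω ↦ pathIntegral f f' (W i · ω) t) -
    fun ω ↦ pathIntegral f f' (W i · ω) s) x * ((fun ω ↦ pathIntegral f f' (W i · ω) t) -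
    fun ω ↦ pathIntegral f f' (W i · ω) s) x) = (((fun ω ↦ pathIntegral f f' (W i · ω) t) -
    fun ω ↦ pathIntegral f f' (W i · ω) s) * ((fun ω ↦ pathIntegral f f' (W i · ω) t) -
    fun ω ↦ pathIntegral f f' (W i · ω) s)) from rfl, ← h, covariance_sub_sub ht hs ht hs]
  simp only [covariance_pathIntegral hW hind hf, if_true, min_self, min_eq_left hst,
    min_eq_right hst]
  ring

/-- If `f` is square integrable, the almost sure limits of the integrals of `f` against independent
Brownian motions are also `L²` limits, by Fatou's lemma and the isometry. They are therefore jointly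
Gaussian, and the isometry passes to the limit. -/
lemma exists_limit_pathIntegral [Fintype ι] [DecidableEq ι]
    (hW : ∀ i, IsRegularBrownian (W i) P)
    (hind : iIndepFun (fun i ω t ↦ W i t ω) P) (hf : HasLocallyIntegrableDeriv f f')
    (hsq : IntegrableOn (fun x ↦ f x ^ 2) (Set.Ioi 0))
    (hconv : ∀ i, ∀ᵐ ω ∂P, ∃ l, Tendsto (fun t ↦ pathIntegral f f' (W i · ω) t) atTop (𝓝 l)) :
    ∃ Z : ι → Ω → ℝ,
      (∀ᵐ ω ∂P, ∀ i, Tendsto (fun t ↦ pathIntegral f f' (W i · ω) t) atTop (𝓝 (Z i ω))) ∧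
      (∀ i, Tendsto (fun t : ℝ≥0 ↦ eLpNorm ((fun ω ↦ pathIntegral f f' (W i · ω) t) - Z i) 2 P)
        atTop (𝓝 0)) ∧
      (∀ i, MemLp (Z i) 2 P) ∧ HasGaussianLaw (fun ω i ↦ Z i ω) P ∧ (∀ i, ∫ ω, Z i ω ∂P = 0) ∧
      ∀ i j, cov[Z i, Z j; P] = if i = j then ∫ x in Set.Ioi 0, f x ^ 2 else 0 := by
  classical
  have := hind.isProbabilityMeasure
  let Z : ι → Ω → ℝ := fun i ω ↦
    if h : ∃ l, Tendsto (fun t ↦ pathIntegral f f' (W i · ω) t) atTop (𝓝 l) then h.choose else 0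
  have hZ : ∀ i, ∀ᵐ ω ∂P, Tendsto (fun t ↦ pathIntegral f f' (W i · ω) t) atTop (𝓝 (Z i ω)) := by
    intro i
    filter_upwards [hconv i] with ω h
    simp only [Z, dif_pos h]
    exact h.choose_spec
  have hm := fun i t ↦ (hW i).measurable_pathIntegral hf t
  have hZm : ∀ i, AEMeasurable (Z i) P := fun i ↦
    aemeasurable_of_tendsto_metrizable_ae atTop (fun t ↦ (hm i t).aemeasurable) (hZ i)
  set I : ℝ≥0 → ℝ := fun t ↦ ∫ x in (0 : ℝ)..t, f x ^ 2 with hI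
  set I' : ℝ := ∫ x in Set.Ioi 0, f x ^ 2 with hI'
  have hIlim : Tendsto I atTop (𝓝 I') :=
    intervalIntegral_tendsto_integral_Ioi 0 hsq (NNReal.tendsto_coe_atTop.2 tendsto_id)
  have hnat : Tendsto (fun m : ℕ ↦ (m : ℝ≥0)) atTop atTop := tendsto_natCast_atTop_atTop
  have hbound : ∀ i t, eLpNorm ((fun ω ↦ pathIntegral f f' (W i · ω) t) - Z i) 2 P ≤
      ENNReal.ofReal √(I' - I t) := by
    intro i t
    rw [eLpNorm_sub_comm]
    refine (Lp.eLpNorm_lim_le_liminf_eLpNorm (f := fun m : ℕ ↦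
      (fun ω ↦ pathIntegral f f' (W i · ω) m) - fun ω ↦ pathIntegral f f' (W i · ω) t)
      (fun m ↦ ((hm i m).sub (hm i t)).aestronglyMeasurable) _ ?_).trans ?_
    · filter_upwards [hZ i] with ω hω
      exact (hω.comp hnat).sub_const _
    · have h : Tendsto (fun m : ℕ ↦ ENNReal.ofReal √(I m - I t)) atTop
          (𝓝 (ENNReal.ofReal √(I' - I t))) :=
        ENNReal.tendsto_ofReal (((hIlim.comp hnat).sub_const _).sqrt)
      refine le_trans (liminf_le_liminf ?_) h.liminf_eq.le
      filter_upwards [hnat.eventually_ge_atTop t] with m hmt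
      rw [eLpNorm_pathIntegral_sub_pathIntegral hW hind hf i hmt]
  have hL2 : ∀ i, Tendsto (fun t : ℝ≥0 ↦ eLpNorm ((fun ω ↦ pathIntegral f f' (W i · ω) t) - Z i)
      2 P) atTop (𝓝 0) := by
    intro i
    refine tendsto_of_tendsto_of_tendsto_of_le_of_le tendsto_const_nhds ?_ (fun _ ↦ zero_le)
      (hbound i)
    have : Tendsto (fun t ↦ ENNReal.ofReal √(I' - I t)) atTop
        (𝓝 (ENNReal.ofReal √(I' - I'))) :=
      ENNReal.tendsto_ofReal ((hIlim.const_sub _).sqrt)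
    simpa using this
  have hZL : ∀ i, MemLp (Z i) 2 P := by
    intro i
    have h1 : MemLp ((fun ω ↦ pathIntegral f f' (W i · ω) 0) - Z i) 2 P :=
      ⟨((hm i 0).aemeasurable.sub (hZm i)).aestronglyMeasurable,
        (hbound i 0).trans_lt ENNReal.ofReal_lt_top⟩
    simpa using ((hW i).memLp_pathIntegral hf 0).sub h1
  have hL2nat := fun i ↦ (hL2 i).comp hnat
  have hMn := fun i (k : ℕ) ↦ (hW i).memLp_pathIntegral hf k
  refine ⟨Z, ae_all_iff.2 hZ, hL2, hZL, ?_, fun i ↦ ?_, fun i j ↦ ?_⟩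
  · have hg : IsGaussianProcess Z P := by
      refine IsGaussianProcess.of_tendsto_eLpNorm
        (Y := fun (k : ℕ) i ω ↦ pathIntegral f f' (W i · ω) k) (fun k ↦ ?_) hZL hL2nat
      exact (isGaussianProcess_pathIntegral hW hind hf).comp_right fun i ↦ (i, (k : ℝ≥0))
    let U : Finset ι := Finset.univ
    let L : (U → ℝ) →L[ℝ] (ι → ℝ) :=
      { toFun := fun x i ↦ x ⟨i, Finset.mem_univ i⟩
        map_add' := fun x y ↦ by ext; simp
        map_smul' := fun c x ↦ by ext; simp }
    exact (hg.hasGaussianLaw U).map L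
  · have h := tendsto_integral_of_tendsto_eLpNorm_two (hMn i) (hZL i) (hL2nat i)
    simp_rw [(hW i).integral_pathIntegral_eq_zero hf] at h
    exact (tendsto_nhds_unique h tendsto_const_nhds)
  · have h1 : Tendsto (fun k : ℕ ↦ cov[fun ω ↦ pathIntegral f f' (W i · ω) k,
        fun ω ↦ pathIntegral f f' (W j · ω) k; P]) atTop (𝓝 cov[Z i, Z j; P]) := by
      simp_rw [covariance_eq_sub (hMn i _) (hMn j _), covariance_eq_sub (hZL i) (hZL j)]
      exact (tendsto_integral_mul_of_tendsto_eLpNorm (hMn i) (hMn j) (hZL i) (hZL j)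
        (hL2nat i) (hL2nat j)).sub
        ((tendsto_integral_of_tendsto_eLpNorm_two (hMn i) (hZL i) (hL2nat i)).mul
          (tendsto_integral_of_tendsto_eLpNorm_two (hMn j) (hZL j) (hL2nat j)))
    simp_rw [covariance_pathIntegral hW hind hf, min_self] at h1
    refine tendsto_nhds_unique h1 ?_
    split_ifs
    · exact hIlim.comp hnat
    · exact tendsto_const_nhds

end Limit

/-! ### Linear growth of Brownian paths and pathwise convergence -/

section Growth

variable {Ω : Type*} {mΩ : MeasurableSpace Ω} {P : Measure Ω}

/-- Brownian paths grow at most linearly. By time inversion, `t ↦ t W (1 / t)` has the law of `W`,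
which is bounded near `0`; this boundedness is tested on countably many times, to be measurable. -/
lemma IsRegularBrownian.ae_exists_bound {W : ℝ≥0 → Ω → ℝ} (hW : IsRegularBrownian W P) :
    ∀ᵐ ω ∂P, ∃ C : ℝ, ∀ t : ℝ≥0, |W t ω| ≤ C * (1 + t) := by
  have := hW.isProbabilityMeasure
  let X : ℝ≥0 → Ω → ℝ := fun t ω ↦ t * W (1 / t) ω
  have hX : IsPreBrownianReal X P := hW.isPreBrownianReal.inv
  have hWm : Measurable fun ω ↦ (W · ω) := measurable_pi_lambda _ hW.measurable
  have hXm : Measurable fun ω ↦ (X · ω) :=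
    measurable_pi_lambda _ fun t ↦ (hW.measurable _).const_mul _
  have hlaw : P.map (fun ω ↦ (W · ω)) = P.map (fun ω ↦ (X · ω)) := by
    rw [map_eq_iff_forall_finset_map_restrict_eq hWm.aemeasurable hXm.aemeasurable]
    exact fun I ↦ (hW.isPreBrownianReal.hasLaw I).map_eq.trans (hX.hasLaw I).map_eq.symm
  let d := TopologicalSpace.denseSeq ℝ≥0
  let A : Set (ℝ≥0 → ℝ) := {x | ∃ k : ℕ, ∀ j, (d j)⁻¹ * (k + 1) ≤ 1 → |x (d j)⁻¹| ≤ 1}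
  have hA : MeasurableSet A := by
    have : A = ⋃ k : ℕ, ⋂ j, ⋂ _ : (d j)⁻¹ * (k + 1) ≤ 1, {x | |x (d j)⁻¹| ≤ 1} := by
      ext x; simp [A]
    rw [this]
    refine MeasurableSet.iUnion fun k ↦ MeasurableSet.iInter fun j ↦ MeasurableSet.iInter fun _ ↦ ?_
    exact measurableSet_le (measurable_pi_apply _).abs measurable_const
  have hWA : ∀ᵐ ω ∂P, (W · ω) ∈ A := by
    filter_upwards [hW.isPreBrownianReal.eval_zero_ae_eq_zero] with ω h0
    have hev : ∀ᶠ t in 𝓝 (0 : ℝ≥0), |W t ω| < 1 := by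
      have : Tendsto (fun t ↦ |W t ω|) (𝓝 0) (𝓝 |W 0 ω|) := (hW.continuous ω).abs.tendsto 0
      rw [h0, abs_zero] at this
      exact this.eventually (gt_mem_nhds one_pos)
    obtain ⟨ε, hε, hball⟩ := Metric.eventually_nhds_iff.1 hev
    obtain ⟨k, hk⟩ := exists_nat_one_div_lt hε
    refine ⟨k, fun j hj ↦ (hball ?_).le⟩
    rw [NNReal.dist_eq, NNReal.coe_zero, sub_zero, abs_of_nonneg (NNReal.coe_nonneg _)]
    refine lt_of_le_of_lt ?_ hk
    rw [le_div_iff₀ (by positivity)]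
    exact_mod_cast hj
  have hXA : ∀ᵐ ω ∂P, (X · ω) ∈ A := by
    have h := (ae_map_iff hWm.aemeasurable hA).2 hWA
    rw [hlaw] at h
    exact (ae_map_iff hXm.aemeasurable hA).1 h
  filter_upwards [hXA] with ω hω
  obtain ⟨k, hk⟩ := hω
  have hseq : ∀ j, (k : ℝ≥0) + 1 ≤ d j → |W (d j) ω| ≤ d j := by
    intro j hj
    have hj0 : 0 < d j := lt_of_lt_of_le (by positivity) hj
    have h := hk j (by rw [inv_mul_le_iff₀ hj0, mul_one]; exact hj)
    have hj0' : (0 : ℝ) < d j := by exact_mod_cast hj0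
    simp only [X] at h
    rw [one_div, inv_inv, abs_mul, NNReal.coe_inv, abs_of_nonneg (by positivity)] at h
    calc |W (d j) ω| = d j * ((d j : ℝ)⁻¹ * |W (d j) ω|) := by field_simp
      _ ≤ d j * 1 := by gcongr
      _ = d j := mul_one _
  have hlarge : ∀ t : ℝ≥0, (k : ℝ≥0) + 1 < t → |W t ω| ≤ t := by
    have hcl : IsClosed {t : ℝ≥0 | |W t ω| ≤ t} :=
      isClosed_le (hW.continuous ω).abs NNReal.continuous_coe
    intro t ht
    refine hcl.closure_subset_iff.2 ?_
      ((TopologicalSpace.denseRange_denseSeq ℝ≥0).open_subset_closure_inter isOpen_Ioi ht)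
    rintro _ ⟨hj, j, rfl⟩
    exact hseq j (le_of_lt hj)
  obtain ⟨M, hM⟩ := (isCompact_Icc (a := (0 : ℝ≥0)) (b := k + 1)).exists_bound_of_continuousOn
    (hW.continuous ω).continuousOn
  have hM0 : 0 ≤ M := (norm_nonneg _).trans (hM 0 ⟨le_rfl, zero_le⟩)
  refine ⟨M + 1, fun t ↦ ?_⟩
  have ht0 := t.coe_nonneg
  rcases le_or_gt t (k + 1) with h | h
  · have := hM t ⟨zero_le, h⟩
    rw [Real.norm_eq_abs] at this
    nlinarith
  · have := hlarge t h
    nlinarith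

/-- Along a path of linear growth, the boundary term of the integration by parts vanishes at infinity
and the remaining integral converges absolutely. -/
lemma tendsto_pathIntegral_of_linear_growth {f f' : ℝ → ℝ}
    (hf0 : Tendsto (fun t ↦ f t * (1 + t)) atTop (𝓝 0))
    (hf' : IntegrableOn (fun s ↦ f' s * (1 + s)) (Set.Ioi 0)) {w : ℝ≥0 → ℝ} (hw : Continuous w)
    {C : ℝ} (hC : ∀ t : ℝ≥0, |w t| ≤ C * (1 + t)) :
    ∃ l, Tendsto (fun t ↦ pathIntegral f f' w t) atTop (𝓝 l) := by
  have hC0 : 0 ≤ C := by simpa using (abs_nonneg _).trans (hC 0)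
  have hcoe : Tendsto (fun t : ℝ≥0 ↦ (t : ℝ)) atTop atTop := NNReal.tendsto_coe_atTop.2 tendsto_id
  have h1 : Tendsto (fun t : ℝ≥0 ↦ f t * w t) atTop (𝓝 0) := by
    have h := ((hf0.comp hcoe).abs.const_mul C)
    rw [abs_zero, mul_zero] at h
    refine squeeze_zero_norm (fun t ↦ ?_) h
    rw [norm_mul, Real.norm_eq_abs, Real.norm_eq_abs, Function.comp_apply, abs_mul,
      abs_of_nonneg (show (0 : ℝ) ≤ 1 + t by positivity)]
    calc |f t| * |w t| ≤ |f t| * (C * (1 + t)) := by gcongr; exact hC t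
      _ = _ := by ring
  have hmeas : AEStronglyMeasurable (fun s ↦ f' s * w s.toNNReal)
      (volume.restrict (Set.Ioi 0)) := by
    have h2 : AEStronglyMeasurable (fun s : ℝ ↦ (1 + s)⁻¹ * w s.toNNReal)
        (volume.restrict (Set.Ioi 0)) := by
      refine Measurable.aestronglyMeasurable ?_
      have := hw.measurable
      fun_prop
    refine (hf'.1.mul h2).congr ?_
    filter_upwards [ae_restrict_mem measurableSet_Ioi] with s hs
    have : (1 : ℝ) + s ≠ 0 := by have : (0 : ℝ) < s := hs; positivity
    simp only [Pi.mul_apply]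
    field_simp
  have hint : IntegrableOn (fun s ↦ f' s * w s.toNNReal) (Set.Ioi 0) := by
    refine (hf'.norm.const_mul C).mono' hmeas ?_
    filter_upwards [ae_restrict_mem measurableSet_Ioi] with s hs
    have hs : (0 : ℝ) < s := hs
    rw [norm_mul, norm_mul, Real.norm_eq_abs, Real.norm_eq_abs, Real.norm_eq_abs,
      abs_of_nonneg (show (0 : ℝ) ≤ 1 + s by positivity)]
    have := hC s.toNNReal
    rw [Real.coe_toNNReal s hs.le] at this
    calc |f' s| * |w s.toNNReal| ≤ |f' s| * (C * (1 + s)) := by gcongr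
      _ = _ := by ring
  exact ⟨_, (h1.sub_const _).sub (intervalIntegral_tendsto_integral_Ioi 0 hint hcoe)⟩

lemma IsRegularBrownian.ae_exists_tendsto_pathIntegral {W : ℝ≥0 → Ω → ℝ}
    (hW : IsRegularBrownian W P) {f f' : ℝ → ℝ}
    (hf0 : Tendsto (fun t ↦ f t * (1 + t)) atTop (𝓝 0))
    (hf' : IntegrableOn (fun s ↦ f' s * (1 + s)) (Set.Ioi 0)) :
    ∀ᵐ ω ∂P, ∃ l, Tendsto (fun t ↦ pathIntegral f f' (W · ω) t) atTop (𝓝 l) := by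
  filter_upwards [hW.ae_exists_bound] with ω ⟨C, hC⟩
  exact tendsto_pathIntegral_of_linear_growth hf0 hf' (hW.continuous ω) hC

end Growth

/-! ### The integrands -/

/-- The integrand `√(1 + κ e^{-ns}) e^{(n-1)s/2}`. -/
noncomputable def kernel (κ n s : ℝ) : ℝ :=
  √(1 + κ * Real.exp (-(n * s))) * Real.exp ((n - 1) / 2 * s)

/-- The derivative of `kernel κ n` on `(0, ∞)`. -/
noncomputable def kernelDeriv (κ n s : ℝ) : ℝ :=
  -(κ * (n * Real.exp (-(n * s)))) / (2 * √(1 + κ * Real.exp (-(n * s)))) *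
    Real.exp ((n - 1) / 2 * s) +
  √(1 + κ * Real.exp (-(n * s))) * ((n - 1) / 2 * Real.exp ((n - 1) / 2 * s))

section Kernel

variable {κ n : ℝ}

lemma one_add_mul_exp_pos (hκ : -1 ≤ κ) (hn : 0 < n) {s : ℝ} (hs : 0 < s) :
    0 < 1 + κ * Real.exp (-(n * s)) := by
  have h1 : Real.exp (-(n * s)) < 1 := by
    rw [← Real.exp_zero, Real.exp_lt_exp]
    linarith [mul_pos hn hs]
  nlinarith [Real.exp_pos (-(n * s))]

lemma hasDerivAt_sqrt_one_add_mul_exp (hκ : -1 ≤ κ) (hn : 0 < n) {s : ℝ} (hs : 0 < s) :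
    HasDerivAt (fun s ↦ √(1 + κ * Real.exp (-(n * s))))
      (-(κ * (n * Real.exp (-(n * s)))) / (2 * √(1 + κ * Real.exp (-(n * s))))) s := by
  have h1 : HasDerivAt (fun s ↦ 1 + κ * Real.exp (-(n * s)))
      (-(κ * (n * Real.exp (-(n * s))))) s := by
    have h0 : HasDerivAt (fun s ↦ -(n * s)) (-n) s := by
      simpa using (hasDerivAt_id' s).const_mul (-n)
    exact ((h0.exp.const_mul κ).const_add 1).congr_deriv (by ring)
  exact h1.sqrt (one_add_mul_exp_pos hκ hn hs).ne'

/-- For `κ = -1` the derivative blows up like `s^(-1/2)` at `0`, but it stays integrable. -/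
lemma hasLocallyIntegrableDeriv_kernel (hκ : -1 ≤ κ) (hn : 0 < n) :
    HasLocallyIntegrableDeriv (kernel κ n) (kernelDeriv κ n) where
  continuous := by unfold kernel; fun_prop
  hasDerivAt s hs := by
    have h2 : HasDerivAt (fun s ↦ Real.exp ((n - 1) / 2 * s))
        ((n - 1) / 2 * Real.exp ((n - 1) / 2 * s)) s := by
      exact (((hasDerivAt_id' s).const_mul ((n - 1) / 2)).exp).congr_deriv (by ring)
    exact (hasDerivAt_sqrt_one_add_mul_exp hκ hn hs).mul h2
  intervalIntegrable t ht := by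
    -- After multiplication by `-κ` the derivative of the square root is nonnegative.
    have h1 : IntervalIntegrable (fun s ↦ -κ * (-(κ * (n * Real.exp (-(n * s)))) /
        (2 * √(1 + κ * Real.exp (-(n * s)))))) volume 0 t := by
      refine intervalIntegral.intervalIntegrable_deriv_of_nonneg
        (g := fun s ↦ -κ * √(1 + κ * Real.exp (-(n * s)))) (by fun_prop) ?_ ?_
      · intro s hs
        rw [min_eq_left ht] at hs
        exact (hasDerivAt_sqrt_one_add_mul_exp hκ hn hs.1).const_mul _
      · intro s _
        have : -κ * (-(κ * (n * Real.exp (-(n * s)))) / (2 * √(1 + κ * Real.exp (-(n * s))))) =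
          κ ^ 2 * (n * Real.exp (-(n * s)) / (2 * √(1 + κ * Real.exp (-(n * s))))) := by ring
        rw [this]
        positivity
    have h2 : IntervalIntegrable (fun s ↦ -(κ * (n * Real.exp (-(n * s)))) /
        (2 * √(1 + κ * Real.exp (-(n * s))))) volume 0 t := by
      refine (h1.const_mul (-κ)⁻¹).congr fun s _ ↦ ?_
      rcases eq_or_ne κ 0 with rfl | h
      · simp
      · exact inv_mul_cancel_left₀ (neg_ne_zero.2 h) _
    exact (h2.mul_continuousOn (by fun_prop)).add
      (Continuous.intervalIntegrable (by fun_prop) _ _)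

lemma kernel_zero (n s : ℝ) : kernel 0 n s = Real.exp ((n - 1) / 2 * s) := by simp [kernel]

lemma abs_sqrt_one_add_sub_one_le {y : ℝ} (hy : -1 ≤ y) : |√(1 + y) - 1| ≤ |y| := by
  have h0 := Real.sqrt_nonneg (1 + y)
  have hsq : √(1 + y) * √(1 + y) = 1 + y := Real.mul_self_sqrt (by linarith)
  have : y = (√(1 + y) - 1) * (√(1 + y) + 1) := by nlinarith
  conv_rhs => rw [this, abs_mul, abs_of_nonneg (by linarith : 0 ≤ √(1 + y) + 1)]
  nlinarith [abs_nonneg (√(1 + y) - 1)]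

lemma abs_kernel_sub_kernel_zero_le (hκ : -1 ≤ κ) (hn : 0 < n) {s : ℝ} (hs : 0 < s) :
    |kernel κ n s - kernel 0 n s| ≤ |κ| * Real.exp (-((n + 1) / 2 * s)) := by
  have h : kernel κ n s - kernel 0 n s =
      (√(1 + κ * Real.exp (-(n * s))) - 1) * Real.exp ((n - 1) / 2 * s) := by
    rw [kernel_zero, kernel]; ring
  rw [h, abs_mul, abs_of_pos (Real.exp_pos ((n - 1) / 2 * s))]
  have h1 := abs_sqrt_one_add_sub_one_le (y := κ * Real.exp (-(n * s)))
    (by linarith [one_add_mul_exp_pos hκ hn hs])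
  rw [abs_mul, abs_of_pos (Real.exp_pos (-(n * s)))] at h1
  calc _ ≤ |κ| * Real.exp (-(n * s)) * Real.exp ((n - 1) / 2 * s) := by gcongr
    _ = |κ| * Real.exp (-((n + 1) / 2 * s)) := by
      rw [mul_assoc, ← Real.exp_add]; ring_nf

lemma one_add_mul_exp_le (hn : 1 ≤ n) {s : ℝ} (hs : 0 ≤ s) :
    (1 + s) * Real.exp (-((n + 1) / 2 * s)) ≤ 2 * Real.exp (-(1 / 2) * s) := by
  have h1 : 1 + s ≤ 2 * Real.exp (1 / 2 * s) := by
    linarith [Real.add_one_le_exp (1 / 2 * s)]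
  calc (1 + s) * Real.exp (-((n + 1) / 2 * s))
      ≤ 2 * Real.exp (1 / 2 * s) * Real.exp (-(1 * s)) := by
        gcongr
        linarith
    _ = 2 * Real.exp (-(1 / 2) * s) := by rw [mul_assoc, ← Real.exp_add]; ring_nf

lemma tendsto_kernel_sub_mul (hκ : -1 ≤ κ) (hn : 1 ≤ n) :
    Tendsto (fun t ↦ (kernel κ n - kernel 0 n) t * (1 + t)) atTop (𝓝 0) := by
  have h : Tendsto (fun t : ℝ ↦ |κ| * (2 * Real.exp (-(1 / 2) * t))) atTop (𝓝 0) := by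
    have : Tendsto (fun t : ℝ ↦ Real.exp (-(1 / 2) * t)) atTop (𝓝 0) :=
      Real.tendsto_exp_atBot.comp ((tendsto_const_mul_atBot_of_neg (by norm_num)).2 tendsto_id)
    simpa using (this.const_mul 2).const_mul |κ|
  refine squeeze_zero_norm' ?_ h
  filter_upwards [eventually_gt_atTop 0] with t ht
  rw [norm_mul, Real.norm_eq_abs, Real.norm_eq_abs, abs_of_pos (show 0 < 1 + t by linarith)]
  calc _ ≤ |κ| * Real.exp (-((n + 1) / 2 * t)) * (1 + t) := by
        gcongr
        exact abs_kernel_sub_kernel_zero_le hκ (by linarith) ht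
    _ = |κ| * ((1 + t) * Real.exp (-((n + 1) / 2 * t))) := by ring
    _ ≤ _ := mul_le_mul_of_nonneg_left (one_add_mul_exp_le hn ht.le) (abs_nonneg κ)

lemma integrableOn_kernel_sub_sq (hκ : -1 ≤ κ) (hn : 1 ≤ n) :
    IntegrableOn (fun s ↦ (kernel κ n - kernel 0 n) s ^ 2) (Set.Ioi 0) := by
  have h := (exp_neg_integrableOn_Ioi 0 (show 0 < n + 1 by linarith)).const_mul (|κ| ^ 2)
  have hc : Continuous fun s ↦ (kernel κ n - kernel 0 n) s ^ 2 := by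
    unfold kernel; fun_prop
  refine h.mono' hc.aestronglyMeasurable ?_
  filter_upwards [ae_restrict_mem measurableSet_Ioi] with s hs
  have h1 := abs_kernel_sub_kernel_zero_le hκ (by linarith : 0 < n) (Set.mem_Ioi.1 hs)
  rw [Real.norm_eq_abs, abs_pow, Pi.sub_apply]
  calc |kernel κ n s - kernel 0 n s| ^ 2 ≤ (|κ| * Real.exp (-((n + 1) / 2 * s))) ^ 2 := by gcongr
    _ = |κ| ^ 2 * Real.exp (-(n + 1) * s) := by
      rw [mul_pow, ← Real.exp_nat_mul]
      congr 2
      push_cast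
      ring

/-- For `s ≥ 1`, away from the singularity of the derivative at `0` for `κ = -1`, the square root in
the denominator is at least `√(1 - e^{-n})`. -/
lemma abs_kernelDeriv_sub_le (hκ : -1 ≤ κ) (hn : 1 ≤ n) {s : ℝ} (hs : 1 ≤ s) :
    |kernelDeriv κ n s - kernelDeriv 0 n s| ≤
      |κ| * (n / (2 * √(1 - Real.exp (-n))) + (n - 1) / 2) * Real.exp (-((n + 1) / 2 * s)) := by
  have hs0 : 0 < s := by linarith
  have hn0 : 0 < n := by linarith
  set u := Real.exp (-(n * s)) with hu
  have hu0 : 0 < u := Real.exp_pos _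
  have hun : u ≤ Real.exp (-n) := Real.exp_le_exp.2 (by nlinarith)
  have hn1 : Real.exp (-n) < 1 := by
    rw [← Real.exp_zero, Real.exp_lt_exp]
    linarith
  set ρ := √(1 - Real.exp (-n)) with hρ
  have hρ0 : 0 < ρ := Real.sqrt_pos.2 (by linarith)
  have hr : ρ ≤ √(1 + κ * u) := Real.sqrt_le_sqrt (by nlinarith)
  have h1 := abs_sqrt_one_add_sub_one_le (y := κ * u)
    (by linarith [one_add_mul_exp_pos hκ hn0 hs0])
  rw [abs_mul, abs_of_pos hu0] at h1
  have h : kernelDeriv κ n s - kernelDeriv 0 n s =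
      (-(κ * (n * u)) / (2 * √(1 + κ * u)) + (n - 1) / 2 * (√(1 + κ * u) - 1)) *
        Real.exp ((n - 1) / 2 * s) := by
    simp only [kernelDeriv, ← hu]
    simp only [zero_mul, add_zero, Real.sqrt_one]
    ring
  have h2 : |-(κ * (n * u)) / (2 * √(1 + κ * u))| ≤ |κ| * u * (n / (2 * ρ)) := by
    rw [abs_div, abs_neg, abs_mul, abs_of_pos (mul_pos hn0 hu0),
      abs_of_pos (by linarith : 0 < 2 * √(1 + κ * u))]
    calc |κ| * (n * u) / (2 * √(1 + κ * u)) ≤ |κ| * (n * u) / (2 * ρ) := by gcongr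
      _ = _ := by ring
  have h3 : |(n - 1) / 2 * (√(1 + κ * u) - 1)| ≤ |κ| * u * ((n - 1) / 2) := by
    rw [abs_mul, abs_of_nonneg (by linarith : 0 ≤ (n - 1) / 2), mul_comm]
    gcongr
  rw [h, abs_mul, abs_of_pos (Real.exp_pos ((n - 1) / 2 * s))]
  calc _ ≤ (|κ| * u * (n / (2 * ρ)) + |κ| * u * ((n - 1) / 2)) * Real.exp ((n - 1) / 2 * s) := by
        gcongr
        exact (abs_add_le _ _).trans (add_le_add h2 h3)
    _ = |κ| * (n / (2 * ρ) + (n - 1) / 2) * (u * Real.exp ((n - 1) / 2 * s)) := by ring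
    _ = _ := by rw [hu, ← Real.exp_add]; ring_nf

lemma measurable_kernelDeriv (κ n : ℝ) : Measurable (kernelDeriv κ n) := by
  unfold kernelDeriv
  fun_prop

lemma integrableOn_kernelDeriv_sub_mul (hκ : -1 ≤ κ) (hn : 1 ≤ n) :
    IntegrableOn (fun s ↦ (kernelDeriv κ n - kernelDeriv 0 n) s * (1 + s)) (Set.Ioi 0) := by
  have hn0 : 0 < n := by linarith
  have hL := (hasLocallyIntegrableDeriv_kernel hκ hn0).sub
    (hasLocallyIntegrableDeriv_kernel (κ := 0) (by norm_num) hn0)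
  rw [← Set.Ioc_union_Ioi_eq_Ioi zero_le_one]
  refine IntegrableOn.union ?_ ?_
  · rw [← intervalIntegrable_iff_integrableOn_Ioc_of_le zero_le_one]
    exact (hL.intervalIntegrable 1 zero_le_one).mul_continuousOn (by fun_prop)
  · set K := |κ| * (n / (2 * √(1 - Real.exp (-n))) + (n - 1) / 2) with hK
    have hK0 : 0 ≤ K := by
      have : 0 ≤ (n - 1) / 2 := by linarith
      positivity
    have h := ((exp_neg_integrableOn_Ioi 1
      (show (0 : ℝ) < 1 / 2 by norm_num)).const_mul 2).const_mul K
    refine h.mono' ?_ ?_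
    · have h1 := measurable_kernelDeriv κ n
      have h2 := measurable_kernelDeriv 0 n
      exact ((h1.sub h2).mul (by fun_prop)).aestronglyMeasurable
    · filter_upwards [ae_restrict_mem measurableSet_Ioi] with s hs
      have hs1 : 1 < s := hs
      rw [norm_mul, Real.norm_eq_abs, Real.norm_eq_abs, abs_of_pos (show 0 < 1 + s by linarith)]
      calc _ ≤ K * Real.exp (-((n + 1) / 2 * s)) * (1 + s) := by
            gcongr
            exact abs_kernelDeriv_sub_le hκ hn hs1.le
        _ = K * ((1 + s) * Real.exp (-((n + 1) / 2 * s))) := by ring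
        _ ≤ _ := mul_le_mul_of_nonneg_left (one_add_mul_exp_le hn (by linarith)) hK0

end Kernel

/-! ### The limiting variances in closed form -/

section Variance

lemma integrableOn_Ioo_rpow {p : ℝ} (hp : -1 < p) :
    IntegrableOn (fun u : ℝ ↦ u ^ p) (Set.Ioo 0 1) := by
  rw [← intervalIntegrable_iff_integrableOn_Ioo_of_le zero_le_one]
  exact intervalIntegral.intervalIntegrable_rpow' hp

lemma integral_Ioo_rpow {p : ℝ} (hp : -1 < p) : ∫ u in Set.Ioo (0 : ℝ) 1, u ^ p = 1 / (p + 1) := by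
  rw [← integral_Ioc_eq_integral_Ioo, ← intervalIntegral.integral_of_le zero_le_one,
    integral_rpow (Or.inl hp), Real.one_rpow, Real.zero_rpow (by linarith), sub_zero]

lemma integrableOn_sqrt_one_add_sub_one_mul_rpow {κ a : ℝ} (hκ : -1 ≤ κ) (ha : 0 < a) :
    IntegrableOn (fun u : ℝ ↦ (√(1 + κ * u) - 1) * u ^ (a - 2)) (Set.Ioo 0 1) := by
  refine ((integrableOn_Ioo_rpow (p := a - 1) (by linarith)).const_mul |κ|).mono'
    (Measurable.aestronglyMeasurable (by fun_prop)) ?_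
  filter_upwards [ae_restrict_mem measurableSet_Ioo] with u hu
  have h1 := abs_sqrt_one_add_sub_one_le (y := κ * u) (by nlinarith [hu.1, hu.2])
  rw [abs_mul, abs_of_pos hu.1] at h1
  rw [norm_mul, Real.norm_eq_abs, Real.norm_eq_abs, abs_of_pos (Real.rpow_pos_of_pos hu.1 _)]
  calc _ ≤ |κ| * u * u ^ (a - 2) := by
        have := (Real.rpow_pos_of_pos hu.1 (a - 2)).le
        gcongr
    _ = |κ| * u ^ (a - 1) := by
        rw [mul_assoc, show a - 1 = 1 + (a - 2) by ring, Real.rpow_add hu.1, Real.rpow_one]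

/-- The substitution `u = e^{-ns}` and the expansion of the square. -/
lemma integral_kernel_sub_sq {κ n : ℝ} (hκ : -1 ≤ κ) (hn : 0 < n) :
    ∫ s in Set.Ioi 0, (kernel κ n - kernel 0 n) s ^ 2 =
      κ - 2 / n * ∫ u in Set.Ioo (0 : ℝ) 1, (√(1 + κ * u) - 1) * u ^ (1 / n - 2) := by
  have hn' : n ≠ 0 := hn.ne'
  have himage : (fun s ↦ Real.exp (-(n * s))) '' Set.Ioi 0 = Set.Ioo 0 1 := by
    ext u
    constructor
    · rintro ⟨s, hs, rfl⟩
      refine ⟨Real.exp_pos _, ?_⟩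
      rw [← Real.exp_zero, Real.exp_lt_exp]
      linarith [mul_pos hn (Set.mem_Ioi.1 hs)]
    · rintro ⟨h0, h1⟩
      refine ⟨-Real.log u / n, div_pos (neg_pos.2 (Real.log_neg h0 h1)) hn, ?_⟩
      simp only
      rw [mul_div_cancel₀ _ hn', neg_neg, Real.exp_log h0]
  have hderiv : ∀ s ∈ Set.Ioi (0 : ℝ), HasDerivWithinAt (fun s ↦ Real.exp (-(n * s)))
      (-(n * Real.exp (-(n * s)))) (Set.Ioi 0) s := fun s _ ↦ by
    have h0 : HasDerivAt (fun s ↦ -(n * s)) (-n) s := by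
      simpa using (hasDerivAt_id' s).const_mul (-n)
    exact (h0.exp.congr_deriv (by ring)).hasDerivWithinAt
  have hinj : Set.InjOn (fun s ↦ Real.exp (-(n * s))) (Set.Ioi 0) := by
    intro s _ t _ h
    have := Real.exp_injective h
    exact mul_left_cancel₀ hn' (neg_injective this)
  have hsub := integral_image_eq_integral_abs_deriv_smul measurableSet_Ioi hderiv hinj
    (fun u ↦ 1 / n * (κ * u ^ (1 / n - 1) - 2 * ((√(1 + κ * u) - 1) * u ^ (1 / n - 2))))
  rw [himage] at hsub
  have hn1 : 0 < 1 / n := by positivity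
  have h1 := (integrableOn_Ioo_rpow (p := 1 / n - 1) (by linarith)).const_mul κ
  have h2 := (integrableOn_sqrt_one_add_sub_one_mul_rpow hκ hn1).const_mul 2
  rw [integral_const_mul, integral_sub h1 h2, integral_const_mul, integral_const_mul,
    integral_Ioo_rpow (by linarith)] at hsub
  have hrhs : 1 / n * (κ * (1 / (1 / n - 1 + 1)) -
      2 * ∫ u in Set.Ioo (0 : ℝ) 1, (√(1 + κ * u) - 1) * u ^ (1 / n - 2)) =
      κ - 2 / n * ∫ u in Set.Ioo (0 : ℝ) 1, (√(1 + κ * u) - 1) * u ^ (1 / n - 2) := by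
    have : 1 / n - 1 + 1 = 1 / n := by ring
    rw [this]
    field_simp
  rw [← hrhs, hsub]
  refine setIntegral_congr_fun measurableSet_Ioi fun s hs ↦ ?_
  have hpos := one_add_mul_exp_pos hκ hn (Set.mem_Ioi.1 hs)
  set u := Real.exp (-(n * s)) with hu
  have hu0 : 0 < u := Real.exp_pos _
  have e1 : u ^ (1 / n - 1) = u * u ^ (1 / n - 2) := by
    conv_rhs => rw [← Real.rpow_one u, ← Real.rpow_mul hu0.le, one_mul, ← Real.rpow_add hu0]
    congr 1
    ring
  have e2 : u * u ^ (1 / n - 2) = Real.exp ((n - 1) / 2 * s) ^ 2 := by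
    rw [← e1, hu, ← Real.exp_mul, ← Real.exp_nat_mul]
    congr 1
    push_cast
    field_simp
    ring
  have hsq : √(1 + κ * u) ^ 2 = 1 + κ * u := Real.sq_sqrt hpos.le
  have hg : (kernel κ n - kernel 0 n) s = (√(1 + κ * u) - 1) * Real.exp ((n - 1) / 2 * s) := by
    rw [Pi.sub_apply, kernel_zero, kernel]; ring
  simp only [smul_eq_mul]
  rw [hg, mul_pow, ← e2, e1, abs_neg, abs_of_pos (mul_pos hn hu0)]
  field_simp
  ring_nf
  rw [hsq]
  ring

/-! #### The radial variance: a beta integral -/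

/-- The beta integral `B(a, 1/2)`. -/
lemma betaIntegral_one_half {a : ℝ} (ha : 0 < a) :
    IntegrableOn (fun u : ℝ ↦ u ^ (a - 1) / √(1 - u)) (Set.Ioo 0 1) ∧
      ∫ u in Set.Ioo (0 : ℝ) 1, u ^ (a - 1) / √(1 - u) =
        Real.Gamma a * √Real.pi / Real.Gamma (a + 1 / 2) := by
  have hconv := Complex.betaIntegral_convergent (u := (a : ℂ)) (v := ((1 / 2 : ℝ) : ℂ))
    (by simpa) (by norm_num)
  have hcongr : ∀ u ∈ Set.Ioo (0 : ℝ) 1, (u : ℂ) ^ ((a : ℂ) - 1) *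
      (1 - (u : ℂ)) ^ (((1 / 2 : ℝ) : ℂ) - 1) = ((u ^ (a - 1) / √(1 - u) : ℝ) : ℂ) := by
    intro u hu
    have h1 : (0 : ℝ) ≤ 1 - u := by linarith [hu.2]
    have h2 : (((1 / 2 : ℝ) : ℂ) - 1) = ((-(1 / 2) : ℝ) : ℂ) := by push_cast; ring
    rw [h2, show (1 - (u : ℂ)) = ((1 - u : ℝ) : ℂ) by push_cast; ring,
      show ((a : ℂ) - 1) = ((a - 1 : ℝ) : ℂ) by push_cast; ring,
      ← Complex.ofReal_cpow hu.1.le, ← Complex.ofReal_cpow h1, ← Complex.ofReal_mul,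
      Real.rpow_neg h1, ← Real.sqrt_eq_rpow, div_eq_mul_inv]
  rw [intervalIntegrable_iff_integrableOn_Ioo_of_le zero_le_one] at hconv
  have hconv' := hconv.congr_fun hcongr measurableSet_Ioo
  constructor
  · have h : Integrable _ _ := hconv'.re
    simpa [IntegrableOn] using h
  · have hval := Complex.betaIntegral_eq_Gamma_mul_div (a : ℂ) ((1 / 2 : ℝ) : ℂ) (by simpa)
      (by norm_num)
    rw [Complex.betaIntegral, intervalIntegral.integral_of_le zero_le_one,
      integral_Ioc_eq_integral_Ioo, setIntegral_congr_fun measurableSet_Ioo hcongr,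
      integral_complex_ofReal, ← Complex.ofReal_add, Complex.Gamma_ofReal, Complex.Gamma_ofReal,
      Complex.Gamma_ofReal, ← Complex.ofReal_mul, ← Complex.ofReal_div, Complex.ofReal_inj,
      Real.Gamma_one_half_eq] at hval
    exact hval

/-- Integration by parts reduces the integral to the beta integral `B(a, 1/2)`; the recursion
`Γ(a) = (a - 1) Γ(a - 1)` then brings in `Γ(a - 1)` at a negative argument. -/
lemma integral_one_sub_sqrt_one_sub_mul_rpow {a : ℝ} (ha : 0 < a) (ha1 : a < 1) :
    ∫ u in Set.Ioo (0 : ℝ) 1, (√(1 + -1 * u) - 1) * u ^ (a - 2) =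
      -(1 / (a - 1) - √Real.pi * Real.Gamma (a - 1) / (2 * Real.Gamma (a + 1 / 2))) := by
  obtain ⟨hβ, hβv⟩ := betaIntegral_one_half ha
  have ha' : a - 1 ≠ 0 := by linarith
  have hint := integrableOn_sqrt_one_add_sub_one_mul_rpow (κ := -1) le_rfl ha
  -- `F` is `(1 - √(1 - u)) u^(a - 1) / (a - 1)`, rewritten so as to be continuous at `0`.
  let F : ℝ → ℝ := fun u ↦ u ^ a / ((1 + √(1 - u)) * (a - 1))
  have hF : ∀ u ∈ Set.Ioo (0 : ℝ) 1, HasDerivAt F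
      (u ^ (a - 1) / √(1 - u) * (1 / (2 * (a - 1))) - (√(1 + -1 * u) - 1) * u ^ (a - 2)) u := by
    intro u hu
    have h1 : 0 < 1 - u := by linarith [hu.2]
    have hr : HasDerivAt (fun u ↦ √(1 - u)) (-1 / (2 * √(1 - u))) u :=
      ((hasDerivAt_id' u).const_sub 1).sqrt h1.ne'
    have hd := ((hr.const_sub 1).mul (Real.hasDerivAt_rpow_const (p := a - 1)
      (Or.inl hu.1.ne'))).div_const (a - 1)
    have heq : F =ᶠ[𝓝 u] fun u ↦ (1 - √(1 - u)) * u ^ (a - 1) / (a - 1) := by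
      filter_upwards [isOpen_Ioo.mem_nhds hu] with v hv
      have hv1 : 0 ≤ 1 - v := by linarith [hv.2]
      have hs : √(1 - v) * √(1 - v) = 1 - v := Real.mul_self_sqrt hv1
      have hs0 : 0 < 1 + √(1 - v) := by positivity
      have hva : v ^ a = v * v ^ (a - 1) := by
        rw [← Real.rpow_one_add' hv.1.le (by linarith)]; congr 1; ring
      simp only [F]
      rw [hva, div_eq_div_iff (by positivity) ha']
      linear_combination (v ^ (a - 1) * (a - 1)) * hs
    refine (hd.congr_of_eventuallyEq heq).congr_deriv ?_
    rw [show a - 1 - 1 = a - 2 by ring, show 1 + -1 * u = 1 - u by ring]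
    have hs0 : √(1 - u) ≠ 0 := (Real.sqrt_pos.2 h1).ne'
    field_simp
    ring
  have hFc : ContinuousOn F (Set.Icc 0 1) := by
    have h0 : Continuous fun u : ℝ ↦ u ^ a := Real.continuous_rpow_const ha.le
    refine Continuous.continuousOn (h0.div (by fun_prop) fun u ↦ mul_ne_zero ?_ ha')
    positivity
  have hβ' := hβ.mul_const (1 / (2 * (a - 1)))
  have hI : IntervalIntegrable (fun u ↦ u ^ (a - 1) / √(1 - u) * (1 / (2 * (a - 1))) -
      (√(1 + -1 * u) - 1) * u ^ (a - 2)) volume 0 1 := by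
    rw [intervalIntegrable_iff_integrableOn_Ioo_of_le zero_le_one]
    exact hβ'.sub hint
  have hftc := intervalIntegral.integral_eq_sub_of_hasDerivAt_of_le zero_le_one hFc hF hI
  rw [intervalIntegral.integral_of_le zero_le_one, integral_Ioc_eq_integral_Ioo,
    integral_sub hβ' hint, integral_mul_const, hβv] at hftc
  have hF1 : F 1 - F 0 = 1 / (a - 1) := by simp [F, Real.zero_rpow ha.ne']
  have hG : Real.Gamma a = (a - 1) * Real.Gamma (a - 1) := by
    have := Real.Gamma_add_one ha'
    rwa [sub_add_cancel] at this
  rw [hF1, hG] at hftc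
  have hG2 : Real.Gamma (a + 1 / 2) ≠ 0 := (Real.Gamma_pos_of_pos (by linarith)).ne'
  have e : (a - 1) * Real.Gamma (a - 1) * √Real.pi / Real.Gamma (a + 1 / 2) *
      (1 / (2 * (a - 1))) = √Real.pi * Real.Gamma (a - 1) / (2 * Real.Gamma (a + 1 / 2)) := by
    field_simp
  rw [e] at hftc
  linarith

theorem integral_kernel_neg_one_sub_sq {n : ℝ} (hn : 1 < n) :
    ∫ s in Set.Ioi 0, (kernel (-1) n - kernel 0 n) s ^ 2 =
      -(√Real.pi * Real.Gamma (-1 + 1 / n) / (n * Real.Gamma (1 / 2 + 1 / n)))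
        - (n + 1) / (n - 1) := by
  have hn0 : 0 < n := by linarith
  have ha1 : 1 / n < 1 := by rw [div_lt_one hn0]; exact hn
  rw [integral_kernel_sub_sq le_rfl hn0, integral_one_sub_sqrt_one_sub_mul_rpow (by positivity) ha1,
    show -1 + 1 / n = 1 / n - 1 by ring, show 1 / 2 + 1 / n = 1 / n + 1 / 2 by ring]
  have hG2 : Real.Gamma (1 / n + 1 / 2) ≠ 0 := (Real.Gamma_pos_of_pos (by positivity)).ne'
  have h1 : 1 / (1 / n - 1) = -(n / (n - 1)) := by
    have : n - 1 ≠ 0 := by linarith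
    have h2 : 1 - n ≠ 0 := by linarith
    have h3 : 1 / n - 1 = (1 - n) / n := by field_simp
    rw [h3, one_div_div, ← div_neg]
    congr 1
    ring
  rw [h1]
  have : n - 1 ≠ 0 := by linarith
  field_simp
  ring

/-! #### The tangential variance: the binomial series -/

/-- The coefficients of `√(1 - y)` in powers of `y`. -/
noncomputable def sqrtCoeff (k : ℕ) : ℝ := (k.factorial : ℝ)⁻¹ * (ascPochhammer ℝ k).eval (-1 / 2)

lemma sqrtCoeff_zero : sqrtCoeff 0 = 1 := by simp [sqrtCoeff]

lemma sqrtCoeff_succ (k : ℕ) : sqrtCoeff (k + 1) = sqrtCoeff k * ((k - 1 / 2) / (k + 1)) := by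
  have : (k.factorial : ℝ) ≠ 0 := by positivity
  simp only [sqrtCoeff, ascPochhammer_succ_eval, Nat.factorial_succ]
  push_cast
  field_simp
  ring

lemma sqrtCoeff_succ_nonpos (k : ℕ) : sqrtCoeff (k + 1) ≤ 0 := by
  induction k with
  | zero => rw [sqrtCoeff_succ, sqrtCoeff_zero]; norm_num
  | succ k ih =>
    rw [sqrtCoeff_succ]
    refine mul_nonpos_of_nonpos_of_nonneg ih (div_nonneg ?_ (by positivity))
    push_cast
    linarith [(Nat.cast_nonneg k : (0 : ℝ) ≤ k)]

/-- The partial sums of the binomial series of `√(1 - y)` at `y = 1`. They are nonnegative, which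
bounds the sum of the absolute values of the later coefficients by `1`. -/
lemma sum_sqrtCoeff (k : ℕ) :
    ∑ j ∈ Finset.range (k + 1), sqrtCoeff j = -2 * (k + 1) * sqrtCoeff (k + 1) := by
  induction k with
  | zero => simp [sqrtCoeff_succ, sqrtCoeff_zero]
  | succ k ih =>
    rw [Finset.sum_range_succ, ih, sqrtCoeff_succ (k + 1)]
    push_cast
    field_simp
    ring

/-- The binomial series of the square root converges absolutely on the circle of convergence. -/
lemma summable_abs_sqrtCoeff_succ : Summable fun k ↦ |sqrtCoeff (k + 1)| := by
  refine summable_of_sum_range_le (c := 1) (fun _ ↦ abs_nonneg _) fun k ↦ ?_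
  simp_rw [abs_of_nonpos (sqrtCoeff_succ_nonpos _)]
  have h := sum_sqrtCoeff k
  rw [Finset.sum_range_succ', sqrtCoeff_zero] at h
  rw [Finset.sum_neg_distrib]
  have : 0 ≤ -2 * ((k : ℝ) + 1) * sqrtCoeff (k + 1) := by
    have := sqrtCoeff_succ_nonpos k
    nlinarith [(Nat.cast_nonneg k : (0 : ℝ) ≤ k)]
  linarith

lemma hasSum_sqrtCoeff {y : ℝ} (hy : |y| < 1) :
    HasSum (fun k ↦ sqrtCoeff k * (-y) ^ k) (√(1 + y)) := by
  have h := (Real.one_add_rpow_hasFPowerSeriesOnBall_zero (a := 1 / 2)).hasSum (y := y)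
    (by simpa [enorm_eq_nnnorm, ← NNReal.coe_lt_coe] using hy)
  rw [binomialSeries_eq_ordinaryHypergeometricSeries (b := (1 : ℝ))
    (fun k ↦ by have : (0 : ℝ) ≤ k := Nat.cast_nonneg k; linarith)] at h
  rw [zero_add, ← Real.sqrt_eq_rpow] at h
  convert! h using 2 with k
  change _ = ordinaryHypergeometricSeries ℝ (-(1 / 2)) 1 1 k fun _ ↦ -y
  have h1 : (ascPochhammer ℝ k).eval 1 ≠ 0 := (ascPochhammer_pos k 1 one_pos).ne'
  rw [ordinaryHypergeometricSeries_apply_eq, mul_assoc _ ((ascPochhammer ℝ k).eval 1),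
    mul_inv_cancel₀ h1, mul_one, smul_eq_mul, sqrtCoeff, neg_div]

/-- Termwise integration of the binomial series. The case `x = 1` of the boundary of the disc of
convergence is included. -/
lemma integral_sqrt_one_add_sub_one_mul_rpow {a x : ℝ} (ha : 0 < a) (hx0 : 0 ≤ x) (hx : x ≤ 1) :
    HasSum (fun k : ℕ ↦ sqrtCoeff (k + 1) * (-x) ^ (k + 1) * (1 / (k + a)))
      (∫ u in Set.Ioo (0 : ℝ) 1, (√(1 + x * u) - 1) * u ^ (a - 2)) := by
  have hp : ∀ k : ℕ, -1 < (k : ℝ) + a - 1 := fun k ↦ by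
    linarith [(Nat.cast_nonneg k : (0 : ℝ) ≤ k)]
  have hI := fun k ↦ (integrableOn_Ioo_rpow (hp k)).const_mul (sqrtCoeff (k + 1) * (-x) ^ (k + 1))
  have hsum := hasSum_integral_of_summable_integral_norm hI ?_
  · have hint : ∀ k : ℕ, ∫ u in Set.Ioo (0 : ℝ) 1,
        sqrtCoeff (k + 1) * (-x) ^ (k + 1) * u ^ ((k : ℝ) + a - 1) =
          sqrtCoeff (k + 1) * (-x) ^ (k + 1) * (1 / (k + a)) := fun k ↦ by
      rw [integral_const_mul, integral_Ioo_rpow (hp k), sub_add_cancel]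
    simp_rw [hint] at hsum
    convert! hsum using 1
    refine setIntegral_congr_fun measurableSet_Ioo fun u hu ↦ ?_
    have hxu : |x * u| < 1 := by
      rw [abs_of_nonneg (mul_nonneg hx0 hu.1.le)]
      nlinarith [hu.1, hu.2]
    have h := (hasSum_nat_add_iff' 1).2 (hasSum_sqrtCoeff hxu)
    simp only [Finset.range_one, Finset.sum_singleton, sqrtCoeff_zero, pow_zero, mul_one] at h
    rw [(h.mul_right (u ^ (a - 2))).tsum_eq.symm]
    refine tsum_congr fun k ↦ ?_
    have : u ^ ((k : ℝ) + a - 1) = u ^ (k + 1) * u ^ (a - 2) := by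
      rw [← Real.rpow_natCast, ← Real.rpow_add hu.1]
      congr 1
      push_cast
      ring
    rw [this]
    ring
  · refine Summable.of_nonneg_of_le (fun k ↦ integral_nonneg fun u ↦ norm_nonneg _) (fun k ↦ ?_)
      (summable_abs_sqrtCoeff_succ.mul_right (1 / a))
    have : ∀ u ∈ Set.Ioo (0 : ℝ) 1, ‖sqrtCoeff (k + 1) * (-x) ^ (k + 1) * u ^ ((k : ℝ) + a - 1)‖ =
        |sqrtCoeff (k + 1)| * x ^ (k + 1) * u ^ ((k : ℝ) + a - 1) := by
      intro u hu
      rw [norm_mul, norm_mul, norm_pow, norm_neg, Real.norm_eq_abs, Real.norm_eq_abs,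
        Real.norm_eq_abs, abs_of_nonneg hx0, abs_of_pos (Real.rpow_pos_of_pos hu.1 _)]
    rw [setIntegral_congr_fun measurableSet_Ioo this, integral_const_mul, integral_Ioo_rpow (hp k),
      sub_add_cancel]
    have hk : (0 : ℝ) ≤ k := Nat.cast_nonneg k
    have hxk : x ^ (k + 1) ≤ 1 := pow_le_one₀ hx0 hx
    have h1 : 1 / ((k : ℝ) + a) ≤ 1 / a := one_div_le_one_div_of_le ha (by linarith)
    calc |sqrtCoeff (k + 1)| * x ^ (k + 1) * (1 / (k + a))
        ≤ |sqrtCoeff (k + 1)| * 1 * (1 / a) := by gcongr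
      _ = _ := by ring

/-- The quotient of the Pochhammer symbols of `a - 1` and `a` telescopes. -/
lemma ascPochhammer_eval_div {a : ℝ} (ha : 0 < a) (ha1 : a < 1) (k : ℕ) :
    (ascPochhammer ℝ k).eval (-1 + a) * ((ascPochhammer ℝ k).eval a)⁻¹ = (a - 1) / (k + a - 1) := by
  induction k with
  | zero =>
    have : a - 1 ≠ 0 := by linarith
    simp [div_self this]
  | succ k ih =>
    have hk : (0 : ℝ) ≤ k := Nat.cast_nonneg k
    have h1 : (k : ℝ) + a ≠ 0 := by linarith
    have h2 : (k : ℝ) + a - 1 ≠ 0 := by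
      rcases Nat.eq_zero_or_pos k with rfl | h
      · simp; linarith
      · have : (1 : ℝ) ≤ k := by exact_mod_cast h
        linarith
    rw [ascPochhammer_succ_eval, ascPochhammer_succ_eval, mul_inv, mul_mul_mul_comm, ih]
    push_cast
    rw [show (k : ℝ) + 1 + a - 1 = k + a by ring, show -1 + a + k = k + a - 1 by ring,
      show a + k = k + a by ring]
    field_simp

/-- An Euler type integral for the hypergeometric function. -/
lemma ordinaryHypergeometric_eq_integral {a x : ℝ} (ha : 0 < a) (ha1 : a < 1) (hx0 : 0 ≤ x)
    (hx : x ≤ 1) :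
    ordinaryHypergeometric (-1 / 2 : ℝ) (-1 + a) a (-x) =
      1 + (a - 1) * ∫ u in Set.Ioo (0 : ℝ) 1, (√(1 + x * u) - 1) * u ^ (a - 2) := by
  have h := (integral_sqrt_one_add_sub_one_mul_rpow ha hx0 hx).mul_left (a - 1)
  have ha' : a - 1 ≠ 0 := by linarith
  rw [ordinaryHypergeometric_eq_tsum]
  have hterm : ∀ k : ℕ, ((k.factorial : ℝ)⁻¹ * (ascPochhammer ℝ k).eval (-1 / 2) *
      (ascPochhammer ℝ k).eval (-1 + a) * ((ascPochhammer ℝ k).eval a)⁻¹) • (-x) ^ k =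
      sqrtCoeff k * ((a - 1) / (k + a - 1)) * (-x) ^ k := fun k ↦ by
    rw [smul_eq_mul, mul_assoc _ (Polynomial.eval (-1 + a) _), ascPochhammer_eval_div ha ha1]
    rfl
  simp_rw [hterm]
  refine HasSum.tsum_eq ((hasSum_nat_add_iff' 1).1 ?_)
  simp only [Finset.range_one, Finset.sum_singleton, sqrtCoeff_zero, pow_zero, mul_one,
    Nat.cast_zero, zero_add, div_self ha', add_sub_cancel_left]
  convert! h using 2 with k
  push_cast
  rw [show (k : ℝ) + 1 + a - 1 = k + a by ring]
  ring

theorem integral_kernel_sub_sq_eq_ordinaryHypergeometric {n : ℝ} (hn : 2 ≤ n) :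
    ∫ s in Set.Ioi 0, (kernel (1 / (n - 1)) n - kernel 0 n) s ^ 2 =
      (2 * ordinaryHypergeometric (-1 / 2 : ℝ) (-1 + 1 / n) (1 / n) (1 / (1 - n)) - 1)
        / (n - 1) := by
  have hn0 : 0 < n := by linarith
  have hn1 : 0 < n - 1 := by linarith
  have hx0 : 0 ≤ 1 / (n - 1) := by positivity
  -- There is equality for `n = 2`, where the series is evaluated on its circle of convergence.
  have hx1 : 1 / (n - 1) ≤ 1 := by rw [div_le_one hn1]; linarith
  have ha1 : 1 / n < 1 := by rw [div_lt_one hn0]; linarith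
  have e : 1 / (1 - n) = -(1 / (n - 1)) := by rw [← neg_sub n 1, one_div_neg_eq_neg_one_div]
  rw [integral_kernel_sub_sq (by linarith) hn0, e,
    ordinaryHypergeometric_eq_integral (by positivity) ha1 hx0 hx1]
  field_simp
  ring

end Variance

/-! ### Convergence of differences of Wiener integrals -/

section Convergence

variable {Ω E ι : Type*} [MeasurableSpace Ω] {P : Measure Ω} [Fintype ι] [NormedAddCommGroup E]
  [InnerProductSpace ℝ E] {X H : ℝ≥0 → Ω → E} {W : ι → ℝ≥0 → Ω → ℝ} {b : ι → E} {f f' g g' : ℝ → ℝ}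

lemma ae_wienerIntegral_sub_wienerIntegral_eq (hW : ∀ i, IsRegularBrownian (W i) P)
    (hX : ∀ᵐ ω ∂P, ∀ t, X t ω - X 0 ω = ∑ i, W i t ω • b i)
    (hf : HasLocallyIntegrableDeriv f f') (hg : HasLocallyIntegrableDeriv g g') :
    ∀ᵐ ω ∂P, ∀ t, wienerIntegral P X f t ω - wienerIntegral P X g t ω =
      ∑ i, pathIntegral (f - g) (f' - g') (W i · ω) t • b i := by
  filter_upwards [(isWienerIntegral_wienerIntegral hW hX hf).ae_eq_sum_pathIntegral hW hX hf,
    (isWienerIntegral_wienerIntegral hW hX hg).ae_eq_sum_pathIntegral hW hX hg] with ω h1 h2 t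
  rw [h1, h2, ← Finset.sum_sub_distrib]
  exact Finset.sum_congr rfl fun i _ ↦ by
    rw [hf.pathIntegral_sub hg ((hW i).continuous ω), sub_smul]

lemma stronglyMeasurable_wienerIntegral_sub (hW : ∀ i, IsRegularBrownian (W i) P)
    (hX : ∀ᵐ ω ∂P, ∀ t, X t ω - X 0 ω = ∑ i, W i t ω • b i)
    (hf : HasLocallyIntegrableDeriv f f') (hg : HasLocallyIntegrableDeriv g g') (t : ℝ≥0) :
    StronglyMeasurable fun ω ↦ wienerIntegral P X f t ω - wienerIntegral P X g t ω :=
  ((isWienerIntegral_wienerIntegral hW hX hf).stronglyMeasurable t).sub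
    ((isWienerIntegral_wienerIntegral hW hX hg).stronglyMeasurable t)

variable [CompleteSpace E] [SecondCountableTopology E] [MeasurableSpace E] [BorelSpace E]

/-- A process which is a linear combination of the integrals of `f` against independent Brownian
motions is a Gaussian martingale. When `f` is square integrable and decays fast enough, it converges
to the same linear combination of independent centered Gaussian variables of variance `∫ f²`. -/
theorem gaussian_martingale_and_exists_limit [DecidableEq ι] (hW : ∀ i, IsRegularBrownian (W i) P)
    (hind : iIndepFun (fun i ω t ↦ W i t ω) P) (hm : ∀ t, StronglyMeasurable (H t))
    (hH : ∀ᵐ ω ∂P, ∀ t, H t ω = ∑ i, pathIntegral f f' (W i · ω) t • b i)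
    (hf : HasLocallyIntegrableDeriv f f')
    (hsq : IntegrableOn (fun x ↦ f x ^ 2) (Set.Ioi 0))
    (hf0 : Tendsto (fun t ↦ f t * (1 + t)) atTop (𝓝 0))
    (hf' : IntegrableOn (fun s ↦ f' s * (1 + s)) (Set.Ioi 0)) :
    IsGaussianProcess H P ∧ (∃ 𝓕 : Filtration ℝ≥0 _, Martingale H 𝓕 P) ∧
      ∃ Z : ι → Ω → ℝ,
        (∀ᵐ ω ∂P, Tendsto (fun t ↦ H t ω) atTop (𝓝 (∑ i, Z i ω • b i))) ∧
        Tendsto (fun t ↦ eLpNorm (fun ω ↦ H t ω - ∑ i, Z i ω • b i) 2 P) atTop (𝓝 0) ∧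
        (∀ i, MemLp (Z i) 2 P) ∧ HasGaussianLaw (fun ω i ↦ Z i ω) P ∧
        (∀ i, ∫ ω, Z i ω ∂P = 0) ∧
        ∀ i j, cov[Z i, Z j; P] = if i = j then ∫ x in Set.Ioi 0, f x ^ 2 else 0 := by
  have hHt : ∀ t, H t =ᵐ[P] fun ω ↦ ∑ i, pathIntegral f f' (W i · ω) t • b i := fun t ↦ by
    filter_upwards [hH] with ω hω using hω t
  obtain ⟨Z, hlim, hL2, hmem, hgauss, hmean, hcov⟩ := exists_limit_pathIntegral hW hind hf hsq
    fun i ↦ (hW i).ae_exists_tendsto_pathIntegral hf0 hf'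
  refine ⟨isGaussianProcess_of_ae_eq_sum_pathIntegral hW hind hf hHt,
    ⟨_, martingale_of_ae_eq_sum_pathIntegral hW hind hf hm hHt⟩, Z, ?_, ?_, hmem, hgauss, hmean,
    hcov⟩
  · filter_upwards [hH, hlim] with ω h1 h2
    simp_rw [h1]
    exact tendsto_finsetSum _ fun i _ ↦ (h2 i).smul_const _
  · refine (tendsto_eLpNorm_sum_smul (b := b) (fun t i ↦
      (((hW i).measurable_pathIntegral hf t).aestronglyMeasurable).sub (hmem i).1) hL2).congr
        fun t ↦ eLpNorm_congr_ae ?_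
    filter_upwards [hHt t] with ω h1
    rw [h1, ← Finset.sum_sub_distrib]
    simp [sub_smul]

end Convergence

/-! ### Orthonormal bases of a hyperplane -/

/-- Entrywise, `sigmaMatrix θ` is the matrix of the orthogonal projection onto the hyperplane
orthogonal to `θ`. -/
lemma sum_mul_orthonormalBasis_orthogonal {n : ℕ} {θ : EuclideanSpace ℝ (Fin n)} (hθ : ‖θ‖ = 1)
    {ι : Type*} [Fintype ι] (b : OrthonormalBasis ι ℝ (ℝ ∙ θ)ᗮ) (i j : Fin n) :
    ∑ k, (b k : EuclideanSpace ℝ (Fin n)) i * (b k : EuclideanSpace ℝ (Fin n)) j =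
      sigmaMatrix θ i j := by
  have h1 : ∀ x : EuclideanSpace ℝ (Fin n), ∑ k, ⟪(b k : EuclideanSpace ℝ (Fin n)), x⟫ •
      (b k : EuclideanSpace ℝ (Fin n)) = x - ⟪θ, x⟫ • θ := fun x ↦ by
    rw [← Submodule.starProjection_unit_singleton ℝ hθ, ← Submodule.starProjection_orthogonal_val,
      b.starProjection_eq_sum_rankOne]
    simp
  have h2 := congrArg (fun v : EuclideanSpace ℝ (Fin n) ↦ v i) (h1 (EuclideanSpace.single j 1))
  simpa [sigmaMatrix, EuclideanSpace.inner_single_right, mul_comm] using h2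

lemma covariance_sum_smul {Ω ι : Type*} [MeasurableSpace Ω] {P : Measure Ω} [IsFiniteMeasure P]
    [Fintype ι] [DecidableEq ι] {Z : ι → Ω → ℝ} {v : ℝ} (hZ : ∀ i, MemLp (Z i) 2 P)
    (hcov : ∀ i j, cov[Z i, Z j; P] = if i = j then v else 0) (x y : ι → ℝ) :
    cov[fun ω ↦ ∑ i, Z i ω * x i, fun ω ↦ ∑ i, Z i ω * y i; P] = v * ∑ i, x i * y i := by
  rw [covariance_fun_sum_fun_sum (fun i ↦ (hZ i).mul_const _) (fun i ↦ (hZ i).mul_const _)]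
  simp_rw [covariance_mul_const_left, covariance_mul_const_right, hcov]
  simp only [ite_mul, zero_mul, Finset.sum_ite_eq, Finset.mem_univ, if_true, Finset.mul_sum,
    mul_assoc]
  exact Finset.sum_congr rfl fun i _ ↦ by rw [mul_comm (y i)]

/-! ### The radial and the tangential process -/

theorem proposition3 {Ω : Type*} [mΩ : MeasurableSpace Ω] (P : Measure Ω) [IsProbabilityMeasure P]
    (n : ℕ) (hn : 2 ≤ n)
    (θ : EuclideanSpace ℝ (Fin n)) (hθ : ‖θ‖ = 1)
    (β : ℝ≥0 → Ω → ℝ) (hβ : IsBrownianReal (fun t ω ↦ β t ω - β 0 ω) P)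
    (B' : ℝ≥0 → Ω → EuclideanSpace ℝ (Fin n)) (hB' : IsBrownianIn (ℝ ∙ θ)ᗮ B' P) :
    -- the process `G⁰ θ`
    (IsGaussianProcess (fun t ω ↦ radialG P n β t ω • θ) P ∧
      (∃ 𝓕 : Filtration ℝ≥0 mΩ, Martingale (fun t ω ↦ radialG P n β t ω • θ) 𝓕 P) ∧
      ∃ Z : Ω → ℝ,
        (∀ᵐ ω ∂P, Tendsto (fun t ↦ radialG P n β t ω • θ) atTop (𝓝 (Z ω • θ))) ∧
        Tendsto (fun t ↦ eLpNorm (fun ω ↦ radialG P n β t ω • θ - Z ω • θ) 2 P) atTop (𝓝 0) ∧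
        HasGaussianLaw Z P ∧
        ∫ ω, Z ω ∂P = 0 ∧
        Var[Z; P] = -(√Real.pi * Real.Gamma (-1 + 1 / n) / (n * Real.Gamma (1 / 2 + 1 / n)))
          - ((n : ℝ) + 1) / (n - 1)) ∧
    -- the process `G'`
    (IsGaussianProcess (tangentialG P n B') P ∧
      (∃ 𝓕 : Filtration ℝ≥0 mΩ, Martingale (tangentialG P n B') 𝓕 P) ∧
      ∃ L : Ω → EuclideanSpace ℝ (Fin n),
        (∀ᵐ ω ∂P, Tendsto (fun t ↦ tangentialG P n B' t ω) atTop (𝓝 (L ω))) ∧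
        Tendsto (fun t ↦ eLpNorm (fun ω ↦ tangentialG P n B' t ω - L ω) 2 P) atTop (𝓝 0) ∧
        HasGaussianLaw L P ∧
        ∫ ω, L ω ∂P = 0 ∧
        ∀ i j : Fin n, cov[fun ω ↦ L ω i, fun ω ↦ L ω j; P] =
          (2 * ordinaryHypergeometric (-1 / 2 : ℝ) (-1 + 1 / n) (1 / n) (1 / (1 - n) : ℝ) - 1)
            / ((n : ℝ) - 1) * sigmaMatrix θ i j) := by
  have hN : (2 : ℝ) ≤ n := by exact_mod_cast hn
  have hκ : (-1 : ℝ) ≤ 1 / ((n : ℝ) - 1) := by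
    have : 0 ≤ 1 / ((n : ℝ) - 1) := one_div_nonneg.2 (by linarith)
    linarith
  have hk0 := hasLocallyIntegrableDeriv_kernel (κ := 0) (n := (n : ℝ)) (by norm_num) (by linarith)
  have e0 : (fun s : ℝ ↦ Real.exp (((n : ℝ) - 1) / 2 * s)) = kernel 0 n :=
    funext fun s ↦ (kernel_zero _ _).symm
  constructor
  · have hk := hasLocallyIntegrableDeriv_kernel (κ := -1) (n := (n : ℝ)) le_rfl (by linarith)
    have e1 : (fun s : ℝ ↦ √(1 - Real.exp (-(n * s))) * Real.exp (((n : ℝ) - 1) / 2 * s)) =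
        kernel (-1) n := by
      ext s
      rw [kernel, neg_one_mul, ← sub_eq_add_neg]
    -- The radial part is driven by one Brownian motion, with coefficient `θ`.
    obtain ⟨W, hW, hβW⟩ := hβ.exists_isRegularBrownian
    have hW' : ∀ i : Unit, IsRegularBrownian ((fun _ : Unit ↦ W) i) P := fun _ ↦ hW
    have hX : ∀ᵐ ω ∂P, ∀ t, β t ω - β 0 ω =
        ∑ i, (fun _ : Unit ↦ W) i t ω • (fun _ : Unit ↦ (1 : ℝ)) i := by
      filter_upwards [hβW] with ω hω t
      simp [hω t]
    obtain ⟨hG, hM, Z, hlim, hL2, -, hgauss, hmean, hcov⟩ :=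
      gaussian_martingale_and_exists_limit (H := fun t ω ↦ radialG P n β t ω • θ)
        (b := fun _ : Unit ↦ θ) hW' iIndepFun.of_subsingleton
        (fun t ↦ by
          simp only [radialG, e0, e1]
          exact (stronglyMeasurable_wienerIntegral_sub hW' hX hk hk0 t).smul_const θ)
        (by
          filter_upwards [ae_wienerIntegral_sub_wienerIntegral_eq hW' hX hk hk0] with ω hω t
          simp only [radialG, e0, e1, hω t]
          simp)
        (hk.sub hk0) (integrableOn_kernel_sub_sq le_rfl (by linarith))
        (tendsto_kernel_sub_mul le_rfl (by linarith))
        (integrableOn_kernelDeriv_sub_mul le_rfl (by linarith))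
    simp only [Finset.univ_unique, Finset.sum_singleton] at hlim hL2
    have hZ : HasGaussianLaw (Z ()) P := hgauss.eval ()
    refine ⟨hG, hM, Z (), hlim, hL2, hZ, hmean (), ?_⟩
    rw [← covariance_self hZ.aemeasurable, hcov, if_pos rfl,
      integral_kernel_neg_one_sub_sq (by linarith)]
  · have hk := hasLocallyIntegrableDeriv_kernel (n := (n : ℝ)) hκ (by linarith)
    have e1 : (fun s : ℝ ↦ √(1 + Real.exp (-(n * s)) / ((n : ℝ) - 1)) *
        Real.exp (((n : ℝ) - 1) / 2 * s)) = kernel (1 / ((n : ℝ) - 1)) n := by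
      ext s
      rw [kernel, one_div_mul_eq_div]
    obtain ⟨b, V, hV, hVind, hVB⟩ := hB'
    choose W hW hVW using fun i ↦ (hV i).exists_isRegularBrownian
    have hind : iIndepFun (fun i ω t ↦ W i t ω) P := hVind.congr fun i ↦ by
      filter_upwards [hVW i] with ω hω using funext hω
    have hX : ∀ᵐ ω ∂P, ∀ t, B' t ω - B' 0 ω =
        ∑ i, W i t ω • (b i : EuclideanSpace ℝ (Fin n)) := by
      filter_upwards [hVB, ae_all_iff.2 hVW] with ω h1 h2 t
      rw [h1]
      exact Finset.sum_congr rfl fun i _ ↦ by rw [h2 i t]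
    obtain ⟨hG, hM, Z, hlim, hL2, hmem, hgauss, hmean, hcov⟩ :=
      gaussian_martingale_and_exists_limit (H := tangentialG P n B')
        (b := fun i ↦ (b i : EuclideanSpace ℝ (Fin n))) hW hind
        (fun t ↦ by
          unfold tangentialG
          simp only [e0, e1]
          exact stronglyMeasurable_wienerIntegral_sub hW hX hk hk0 t)
        (by
          filter_upwards [ae_wienerIntegral_sub_wienerIntegral_eq hW hX hk hk0] with ω hω t
          simp only [tangentialG, e0, e1]
          exact hω t)
        (hk.sub hk0) (integrableOn_kernel_sub_sq hκ (by linarith))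
        (tendsto_kernel_sub_mul hκ (by linarith))
        (integrableOn_kernelDeriv_sub_mul hκ (by linarith))
    let T : (Fin (Module.finrank ℝ (ℝ ∙ θ)ᗮ) → ℝ) →L[ℝ] EuclideanSpace ℝ (Fin n) :=
      ∑ i, (ContinuousLinearMap.proj i).smulRight (b i : EuclideanSpace ℝ (Fin n))
    have hT : ∀ ω, T (fun i ↦ Z i ω) = ∑ i, Z i ω • (b i : EuclideanSpace ℝ (Fin n)) := fun ω ↦ by
      simp [T]
    refine ⟨hG, hM, _, hlim, hL2, ?_, ?_, fun i j ↦ ?_⟩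
    · simpa only [hT] using hgauss.map_fun T
    · rw [integral_finsetSum _ fun i _ ↦ ((hmem i).integrable (by norm_num)).smul_const _]
      simp [integral_smul_const, hmean]
    · simp only [WithLp.ofLp_sum, Finset.sum_apply, WithLp.ofLp_smul, Pi.smul_apply, smul_eq_mul]
      rw [covariance_sum_smul hmem hcov, sum_mul_orthonormalBasis_orthogonal hθ,
        integral_kernel_sub_sq_eq_ordinaryHypergeometric hN]
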